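/- **Conventions.** A *plane graph* is a finite simple graph $G=(V,E)$ drawn in $\mathbb R^2$ without crossings: vertices are points, edges are simple polygonal arcs joining their two end vertices and containing no other vertex, and two distinct edges meet only in vertices. For a set $C$ consisting of one vertex $v$ or of two distinct vertices $v,w$, let $N(C)$ be the set of vertices outside $C$ with a neighbour in $C$, and - $N_1(C)=\{u\in N(C): N(u)\setminus (N(C)\cup C)\neq\emptyset\}$, - $N_2(C)=\{u\in N(C)\setminus N_1(C): N(u)\cap N_1(C)\ne\emptyset\}$, - $N_3(C)=N(C)\setminus(N_1(C)\cup N_2(C))$, and $N_{2,3}(C)=N_2(C)\cup N_3(C)$; write $N_i(v)$, $N_i(v,w)$ for $C=\{v\}$, $C=\{v,w\}$. For $S\subseteq V$, an *$S$-total dominating set* is a set $D\subseteq S\cup N(S)$ dominating $S$ such that no vertex of $S$ is isolated in $G[D]$. For $v\ne w$ let $\mathcal D_v$ be the family of sets $D$ with $v\in D\subseteq N_{2,3}(v,w)\cup\{v\}$, $|D|\le 3$ and $N_3(v,w)\subseteq\bigcup_{u\in D}N(u)$; $\mathcal D_w$ is defined symmetrically. A *simple region* between two distinct vertices $v,w$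 is a closed set $R\subseteq\mathbb R^2$ whose boundary is formed by two (not necessarily disjoint) simple paths of $G$ of length at most two connecting $v$ and $w$, and such that, with $V(R)=V\cap R$, every vertex of $V(R)\setminus\{v,w\}$ is a common neighbour of $v$ and $w$. The *size* of $R$ is $|V(R)|$; a simple region between $v,w$ is *maximal* if no simple region $R'$ between $v,w$ satisfies $V(R)\subsetneq V(R')$. To *shrink* a family of regions means: while one of these regions has size more than $7$, remove a vertex strictly inside it. **Rule 1.** If $v\in V$ satisfies $N_3(v)\neq\emptyset$: remove $N_{2,3}(v)$ and add a new vertex $v'$ with the edge $\{v,v'\}$. **Rule 2.** If $v\ne w$ are vertices such that no $N_3(v,w)$-total dominating set of size at most $3$ is contained in $N_{2,3}(v,w)$: 1. if $\mathcal D_v=\mathcal D_w=\emptyset$: remove $N_3(v,w)$, add new vertices $v',w'$ with the edges $\{v,v'\},\{w,w'\}$ and, if $v,w$ have a common neighbour in $N_3(v,w)$, a new vertex $y$ with the edges $\{v,y\},\{w,y\}$; 2. if $\mathcal D_v\ne\emptyset\ne\mathcal D_w$: for an arbitrary $D\in\mathcal D_v$, shrink the family of all maximal simple regions between $w$ and the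 vertices $u\in D$; then do the same symmetrically for $\mathcal D_w$; 3. if $\mathcal D_v\neq\emptyset=\mathcal D_w$: add a new vertex $v'$ with the edge $\{v,v'\}$; for an arbitrary $D\in\mathcal D_v$, shrink the family $\mathcal R$ of all maximal simple regions between $w$ and the vertices $u\in D\setminus\{v\}$; remove $N_{2,3}(v)\cap N_3(v,w)$ (the sets of the original graph); shrink the family of all maximal simple regions between $v$ and the vertices on the boundaries of the regions in $\mathcal R$; 4. if $\mathcal D_v=\emptyset\ne\mathcal D_w$: symmetrically to 3. $G$ is *reduced* under Rules 1 and 2 if neither rule can be applied to it with an effect: every application of a rule to $G$, whatever choices are made, results in a graph isomorphic to $G$. **Lemma.** Let $G$ be a plane graph reduced under Rules 1 and 2, let $v,w$ be two distinct vertices and let $R$ be a simple region between $v$ and $w$. Then $|V(R)|\le 11$, that is, $R$ contains at most $9$ vertices distinct from $v$ and $w$. -/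

import Mathlib

open Set

/-! ## Neighbourhoods, confinement layers, total domination -/

namespace SimpleGraph

variable {V : Type*} (G : SimpleGraph V)

/-- Neighbourhood of a core `C` of vertices: vertices outside `C` with a neighbour in `C`.
`nbhd {v}` is `N(v)` and `nbhd {v, w}` is `N(v, w) = (N(v) ∪ N(w)) \ {v, w}`. -/
def nbhd (C : Set V) : Set V := {u | u ∉ C ∧ ∃ c ∈ C, G.Adj c u}

/-- `N₁(C)`: vertices of `N(C)` having a neighbour outside `N(C) ∪ C`. -/
def nbhd₁ (C : Set V) : Set V :=
  {u | u ∈ G.nbhd C ∧ (G.neighborSet u \ (G.nbhd C ∪ C)).Nonempty}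

/-- `N₂(C)`: vertices of `N(C) \ N₁(C)` having a neighbour in `N₁(C)`. -/
def nbhd₂ (C : Set V) : Set V :=
  {u | u ∈ G.nbhd C \ G.nbhd₁ C ∧ (G.neighborSet u ∩ G.nbhd₁ C).Nonempty}

/-- `N₃(C)`: the remaining vertices of `N(C)`. -/
def nbhd₃ (C : Set V) : Set V := G.nbhd C \ (G.nbhd₁ C ∪ G.nbhd₂ C)

/-- `N_{2,3}(C) = N₂(C) ∪ N₃(C)`. -/
def nbhd₂₃ (C : Set V) : Set V := G.nbhd₂ C ∪ G.nbhd₃ C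

/-- `D` is an `S`-total dominating set: `D ⊆ S ∪ N(S)`, `D` dominates `S`, and no vertex of `S`
is isolated in `G[D]`. -/
def IsTDS (S D : Set V) : Prop :=
  D ⊆ S ∪ G.nbhd S ∧ (∀ s ∈ S, s ∈ D ∨ ∃ d ∈ D, G.Adj s d) ∧
    ∀ s ∈ S ∩ D, ∃ d ∈ D, G.Adj s d

/-- There is an `N₃(v,w)`-total dominating set of size at most three inside `N_{2,3}(v,w)`. -/
def HasSmallTDS (v w : V) : Prop :=
  ∃ D : Finset V, D.card ≤ 3 ∧ (D : Set V) ⊆ G.nbhd₂₃ {v, w} ∧ G.IsTDS (G.nbhd₃ {v, w}) D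

/-- The family `𝒟_v` for the pair `v, w` (and `𝒟_w` is `domSets w v`): sets `D` of size at most
three with `v ∈ D ⊆ N_{2,3}(v,w) ∪ {v}` such that every vertex of `N₃(v,w)` has a neighbour
in `D`. -/
def domSets (v w : V) : Set (Finset V) :=
  {D | D.card ≤ 3 ∧ v ∈ D ∧ (D : Set V) ⊆ G.nbhd₂₃ {v, w} ∪ {v} ∧
    G.nbhd₃ {v, w} ⊆ ⋃ u ∈ D, G.neighborSet u}

end SimpleGraph

/-! ## Plane graphs -/

/-- The Euclidean plane. -/
abbrev Plane : Type := EuclideanSpace ℝ (Fin 2)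

/-- `e` is an arc from `x` to `y`, that is, a simple polygonal curve: the union of the segments
joining consecutive points of a finite sequence `p 0 = x, …, p n = y`, where two segments meet only
if they are consecutive, and then only in their common end point. -/
def IsArc (x y : Plane) (e : Set Plane) : Prop :=
  ∃ (n : ℕ) (p : ℕ → Plane), 0 < n ∧ p 0 = x ∧ p n = y ∧ (∀ i < n, p i ≠ p (i + 1)) ∧
    (∀ i j, i < j → j < n → ∀ z ∈ segment ℝ (p i) (p (i + 1)) ∩ segment ℝ (p j) (p (j + 1)),
      j = i + 1 ∧ z = p j) ∧
    e = ⋃ i < n, segment ℝ (p i) (p (i + 1))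

theorem IsArc.symm {x y : Plane} {e : Set Plane} (h : IsArc x y e) : IsArc y x e := by
  obtain ⟨n, p, hn, hx, hy, hne, hint, rfl⟩ := h
  have key : ∀ i < n, segment ℝ (p (n - i)) (p (n - (i + 1))) =
      segment ℝ (p (n - 1 - i)) (p (n - 1 - i + 1)) := by
    intro i hi
    rw [segment_symm, show n - (i + 1) = n - 1 - i by omega, show n - i = n - 1 - i + 1 by omega]
  refine ⟨n, fun i => p (n - i), hn, by simpa using hy, by simpa using hx, ?_, ?_, ?_⟩
  · intro i hi h
    apply hne (n - 1 - i) (by omega)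
    rw [show n - 1 - i + 1 = n - i by omega, show n - 1 - i = n - (i + 1) by omega]
    exact h.symm
  · intro i j hij hj z hz
    simp only [key i (by omega), key j hj] at hz
    obtain ⟨h1, h2⟩ := hint (n - 1 - j) (n - 1 - i) (by omega) (by omega) z hz.symm
    refine ⟨by omega, ?_⟩
    rw [h2, show n - 1 - i = n - j by omega]
  · ext z
    simp only [mem_iUnion, exists_prop]
    constructor
    · rintro ⟨i, hi, hz⟩
      refine ⟨n - 1 - i, by omega, ?_⟩
      rw [key _ (by omega), show n - 1 - (n - 1 - i) = i by omega]
      exact hz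
    · rintro ⟨i, hi, hz⟩
      rw [key i hi] at hz
      exact ⟨n - 1 - i, by omega, hz⟩

theorem IsArc.ne {x y : Plane} {e : Set Plane} (h : IsArc x y e) : x ≠ y := by
  obtain ⟨n, p, hn, hx, hy, hne, hint, -⟩ := h
  rintro rfl
  rcases Nat.lt_or_ge 1 n with h1 | h1
  · have hz := hint 0 (n - 1) (by omega) (by omega) (p 0)
      ⟨left_mem_segment ℝ _ _, by
        rw [show n - 1 + 1 = n by omega, hx, hy]; exact right_mem_segment ℝ _ _⟩
    have h2 := hne 0 hn
    rw [hz.1] at hz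
    exact h2 hz.2
  · obtain rfl : n = 1 := by omega
    exact hne 0 hn (by rw [hx, hy])

/-- A (finite, simple) plane graph: a finite set of points of the plane, and a set of arcs joining
two of these points and containing no further one, with at most one arc between two points, and
such that distinct arcs meet only in vertices. -/
structure PlaneGraph where
  verts : Set Plane
  edges : Set (Set Plane)
  finite_verts : verts.Finite
  isArc_edges : ∀ e ∈ edges, ∃ x ∈ verts, ∃ y ∈ verts, IsArc x y e ∧ e ∩ verts = {x, y}
  simple : ∀ e ∈ edges, ∀ f ∈ edges, e ∩ verts = f ∩ verts → e = f
  noncrossing : ∀ e ∈ edges, ∀ f ∈ edges, e ≠ f → e ∩ f ⊆ verts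

namespace PlaneGraph

/-- The underlying abstract graph, on the set of all points (points which are not vertices are
isolated in it). -/
def graph (G : PlaneGraph) : SimpleGraph Plane where
  Adj x y := ∃ e ∈ G.edges, IsArc x y e
  symm := ⟨fun _ _ ⟨e, he, h⟩ => ⟨e, he, h.symm⟩⟩
  loopless := ⟨fun _ ⟨_, _, h⟩ => h.ne rfl⟩

/-- Isomorphism of the underlying abstract graphs. -/
def Iso (G H : PlaneGraph) : Prop :=
  Nonempty (G.graph.induce G.verts ≃g H.graph.induce H.verts)

/-- The plane graph obtained by deleting the vertices in `X` with their incident edges. -/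
def delete (G : PlaneGraph) (X : Set Plane) : PlaneGraph where
  verts := G.verts \ X
  edges := {e ∈ G.edges | Disjoint (e ∩ G.verts) X}
  finite_verts := G.finite_verts.subset sdiff_subset
  isArc_edges := by
    rintro e ⟨he, hd⟩
    obtain ⟨x, hx, y, hy, ha, hv⟩ := G.isArc_edges e he
    have hd' := Set.disjoint_left.1 hd
    have hxe : x ∈ e ∩ G.verts := by rw [hv]; simp
    have hye : y ∈ e ∩ G.verts := by rw [hv]; simp
    refine ⟨x, ⟨hx, hd' hxe⟩, y, ⟨hy, hd' hye⟩, ha, ?_⟩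
    rw [← hv]
    ext z
    exact ⟨fun h => ⟨h.1, h.2.1⟩, fun h => ⟨h.1, h.2, hd' h⟩⟩
  simple := by
    rintro e ⟨he, hde⟩ f ⟨hf, hdf⟩ h
    refine G.simple e he f hf ?_
    have aux : ∀ g : Set Plane, Disjoint (g ∩ G.verts) X → g ∩ (G.verts \ X) = g ∩ G.verts :=
      fun g hg => by
        ext z
        exact ⟨fun h => ⟨h.1, h.2.1⟩, fun h => ⟨h.1, h.2, Set.disjoint_left.1 hg h⟩⟩
    rwa [aux e hde, aux f hdf] at h
  noncrossing := by
    rintro e ⟨he, hde⟩ f ⟨hf, hdf⟩ hne z hz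
    have hzv := G.noncrossing e he f hf hne hz
    exact ⟨hzv, Set.disjoint_left.1 hde ⟨hz.1, hzv⟩⟩

/-- `G'` arises from `G` by adding (and drawing somewhere in the plane, without crossings) one new
vertex whose neighbours are exactly the points of `A`. -/
def AddVertex (G : PlaneGraph) (A : Set Plane) (G' : PlaneGraph) : Prop :=
  ∃ x ∈ G'.verts, G'.delete {x} = G ∧ G'.graph.neighborSet x = A

/-! ## Simple regions -/

/-- The set of points of the plane covered by (the drawing of the edges of) a walk. -/
def drawing (G : PlaneGraph) {v w : Plane} (P : G.graph.Walk v w) : Set Plane :=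
  {z | ∃ d ∈ P.darts, ∃ e ∈ G.edges, IsArc d.fst d.snd e ∧ z ∈ e}

/-- `V(R)`: the vertices lying in `R` (strictly inside it or on its boundary). -/
def vertsIn (G : PlaneGraph) (R : Set Plane) : Set Plane := G.verts ∩ R

/-- `R` is a simple region between the distinct vertices `v` and `w`: a closed subset of the plane
whose boundary is formed by two (not necessarily disjoint) simple paths of length at most two
connecting `v` and `w`, and all of whose vertices other than `v, w` are common neighbours
of `v` and `w`. -/
def IsSimpleRegion (G : PlaneGraph) (v w : Plane) (R : Set Plane) : Prop :=
  v ≠ w ∧ IsClosed R ∧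
  (∃ P Q : G.graph.Walk v w, P.IsPath ∧ Q.IsPath ∧ P.length ≤ 2 ∧ Q.length ≤ 2 ∧
    frontier R = G.drawing P ∪ G.drawing Q) ∧
  G.vertsIn R \ {v, w} ⊆ G.graph.neighborSet v ∩ G.graph.neighborSet w

/-- A simple region between `v` and `w` that is maximal: no simple region between `v` and `w`
contains all of its vertices and a further one. -/
def IsMaximalSimpleRegion (G : PlaneGraph) (v w : Plane) (R : Set Plane) : Prop :=
  G.IsSimpleRegion v w R ∧
    ∀ R', G.IsSimpleRegion v w R' → G.vertsIn R ⊆ G.vertsIn R' → G.vertsIn R' ⊆ G.vertsIn R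

/-- The maximal simple regions between `w` and the elements of `U`. -/
def maximalRegions (G : PlaneGraph) (w : Plane) (U : Set Plane) : Set (Set Plane) :=
  {R | ∃ u ∈ U, G.IsMaximalSimpleRegion w u R}

/-! ## The reduction rules

The rules are nondeterministic: `Rule G G'` means that `G'` is a possible result of one application
of the rule to `G`. -/

/-- One pass through the body of the loop: some region of the family `𝓡` has more than seven
vertices, and one vertex strictly inside that region is removed. -/
def ShrinkStep (𝓡 : Set (Set Plane)) (G G' : PlaneGraph) : Prop :=
  ∃ R ∈ 𝓡, 7 < (G.vertsIn R).ncard ∧ ∃ x ∈ G.verts, x ∈ interior R ∧ G' = G.delete {x}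

/-- The whole loop: while some region of `𝓡` has more than seven vertices, remove a vertex strictly
inside that region. -/
def Shrink (𝓡 : Set (Set Plane)) (G G' : PlaneGraph) : Prop :=
  Relation.ReflTransGen (ShrinkStep 𝓡) G G' ∧ ∀ R ∈ 𝓡, (G'.vertsIn R).ncard ≤ 7

/-- Rule 1: for a vertex `v` with `N₃(v) ≠ ∅`, remove `N_{2,3}(v)` and add a new vertex with
`v` as its only neighbour. -/
def Rule1 (G G' : PlaneGraph) : Prop :=
  ∃ v ∈ G.verts, (G.graph.nbhd₃ {v}).Nonempty ∧
    (G.delete (G.graph.nbhd₂₃ {v})).AddVertex {v} G'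

/-- Rule 2, Case 1 (`𝒟_v = 𝒟_w = ∅`): remove `N₃(v,w)`, add a new neighbour of `v` and a new
neighbour of `w`, both of degree one, and, if `v` and `w` had a common neighbour in `N₃(v,w)`, add
a new vertex with the neighbours `v` and `w`. -/
def Rule2Case1 (G : PlaneGraph) (v w : Plane) (G' : PlaneGraph) : Prop :=
  G.graph.domSets v w = ∅ ∧ G.graph.domSets w v = ∅ ∧
  ∃ H₁ H₂ : PlaneGraph, (G.delete (G.graph.nbhd₃ {v, w})).AddVertex {v} H₁ ∧
    H₁.AddVertex {w} H₂ ∧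
    (((∃ u ∈ G.graph.nbhd₃ {v, w}, G.graph.Adj v u ∧ G.graph.Adj w u) ∧
        H₂.AddVertex {v, w} G') ∨
      ((¬ ∃ u ∈ G.graph.nbhd₃ {v, w}, G.graph.Adj v u ∧ G.graph.Adj w u) ∧ G' = H₂))

/-- Rule 2, Case 2 (`𝒟_v ≠ ∅`, `𝒟_w ≠ ∅`): for an arbitrary `D ∈ 𝒟_v`, shrink the maximal simple
regions between `w` and the elements of `D`; then do the same symmetrically for `𝒟_w`. -/
def Rule2Case2 (G : PlaneGraph) (v w : Plane) (G' : PlaneGraph) : Prop :=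
  ∃ D ∈ G.graph.domSets v w, ∃ D' ∈ G.graph.domSets w v, ∃ H : PlaneGraph,
    Shrink (G.maximalRegions w (D : Set Plane)) G H ∧
    Shrink (H.maximalRegions v (D' : Set Plane)) H G'

/-- Rule 2, Case 3 (`𝒟_v ≠ ∅`, `𝒟_w = ∅`): add a new vertex whose only neighbour is `v`; for an
arbitrary `D ∈ 𝒟_v`, shrink the maximal simple regions between `w` and the elements of `D \ {v}`;
remove `N_{2,3}(v) ∩ N₃(v,w)`; finally shrink the maximal simple regions between `v` and the
vertices on the boundary of the regions considered before. -/
def Rule2Case3 (G : PlaneGraph) (v w : Plane) (G' : PlaneGraph) : Prop :=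
  G.graph.domSets w v = ∅ ∧
  ∃ D ∈ G.graph.domSets v w, ∃ H₀ H₁ H₂ : PlaneGraph,
    G.AddVertex {v} H₀ ∧
    Shrink (H₀.maximalRegions w ((D : Set Plane) \ {v})) H₀ H₁ ∧
    H₂ = H₁.delete (G.graph.nbhd₂₃ {v} ∩ G.graph.nbhd₃ {v, w}) ∧
    Shrink (H₂.maximalRegions v
      {u ∈ H₂.verts | ∃ R ∈ H₀.maximalRegions w ((D : Set Plane) \ {v}), u ∈ frontier R}) H₂ G'

/-- Rule 2, for two distinct vertices `v, w` such that no `N₃(v,w)`-total dominating set of size at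
most three lies in `N_{2,3}(v,w)`. The last alternative is Case 4, symmetric to Case 3. -/
def Rule2 (G G' : PlaneGraph) : Prop :=
  ∃ v ∈ G.verts, ∃ w ∈ G.verts, v ≠ w ∧ ¬ G.graph.HasSmallTDS v w ∧
    (G.Rule2Case1 v w G' ∨ G.Rule2Case2 v w G' ∨ G.Rule2Case3 v w G' ∨ G.Rule2Case3 w v G')

/-- `G` is reduced under Rules 1 and 2: neither rule can be applied to `G` with an effect any more,
i.e. whatever choices are made, an application gives back the same graph up to isomorphism.
(Replacing a vertex of degree one by a new one is always possible and has no effect.) -/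
def Reduced (G : PlaneGraph) : Prop :=
  (∀ G', G.Rule1 G' → G.Iso G') ∧ (∀ G', G.Rule2 G' → G.Iso G')

end PlaneGraph

/-! Suppose a simple region R between v and w has at least 12 vertices. Edges do not leave R from
its interior, so an inner vertex is never in N₁(v,w); if it is not in N₃(v,w) either, it is adjacent
to one of the at most two boundary vertices p, q other than v, w. Planarity limits this. As there is
no K₃,₃ (`not_completeBipartite`), a vertex other than v, w has at most two neighbours among the
common neighbours of v and w in R; and if p and q are distinct, each has at most one neighbour
inside (`not_adj_two_interior`). Hence at least six inner vertices lie in N₃(v,w). A total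
dominating set of at most three vertices other than v, w would dominate six of them only in a tight
situation, where it would induce a perfect matching on three vertices. So there is none
(`six_le_and_not_hasSmallTDS`), and Rule 2 applies to v, w.

Since isomorphic graphs have equally many vertices, it suffices to find in each case of Rule 2 one
outcome with fewer vertices. Case 1 deletes at least six vertices and adds three. In Case 2 a
maximal region containing the vertices of R is shrunk from at least 12 vertices to at most 7. Case 3
adds one vertex; then either at least six vertices of N₃(v,w) are deleted (v adjacent to w), or R
survives up to the last step and is shrunk there. The new vertices must really be drawn: in Case 1
they reuse places of deleted ones, in Case 3 a short segment in a generic direction is added.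

The two planarity facts do not rest on the Jordan curve theorem. Off an arc from x to y there is a
continuous logarithm of (y - z)/(x - z); the difference of two of them is constant on connected sets
avoiding both arcs and x. For three arcs with distinct directions at x, a cyclic sum of such
differences near x is ±2πi (`theta_ne_zero`), whereas it would vanish if a connection off the arcs
let all three differences be evaluated at one point. -/

/-! ## Polygonal arcs -/

/-- The plane as the complex line. -/
noncomputable def planeToComplex : Plane ≃ₗᵢ[ℝ] ℂ := Complex.orthonormalBasisOneI.repr.symm

/-- The point at angle `θ` of the circle of radius `r` around `x`. -/
noncomputable def circlePoint (x : Plane) (r θ : ℝ) : Plane :=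
  x + planeToComplex.symm (r * Complex.exp (θ * Complex.I))

theorem continuous_circlePoint (x : Plane) (r : ℝ) : Continuous (circlePoint x r) := by
  unfold circlePoint
  exact continuous_const.add (planeToComplex.symm.continuous.comp (by fun_prop))

theorem dist_circlePoint (x : Plane) {r : ℝ} (hr : 0 ≤ r) (θ : ℝ) :
    dist (circlePoint x r θ) x = r := by
  simp [circlePoint, dist_eq_norm, Complex.norm_exp_ofReal_mul_I, abs_of_nonneg hr]

theorem circlePoint_ne (x : Plane) {r : ℝ} (hr : 0 < r) (θ : ℝ) : circlePoint x r θ ≠ x := by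
  intro h
  have := dist_circlePoint x hr.le θ
  rw [h, dist_self] at this
  exact hr.ne this

theorem planeToComplex_circlePoint_sub (x : Plane) (r θ : ℝ) :
    planeToComplex (circlePoint x r θ - x) = r * Complex.exp (θ * Complex.I) := by
  simp [circlePoint]

theorem circlePoint_arg {x z : Plane} {r : ℝ} (h : dist z x = r) :
    circlePoint x r (planeToComplex (z - x)).arg = z := by
  have h1 : ‖planeToComplex (z - x)‖ = r := by rw [LinearIsometryEquiv.norm_map, ← dist_eq_norm, h]
  have h2 := Complex.norm_mul_exp_arg_mul_I (planeToComplex (z - x))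
  rw [h1] at h2
  rw [circlePoint, h2]
  simp

theorem circlePoint_add_two_pi (x : Plane) (r θ : ℝ) :
    circlePoint x r (θ + 2 * Real.pi) = circlePoint x r θ := by
  unfold circlePoint
  congr 3
  push_cast
  rw [add_mul, Complex.exp_add, Complex.exp_two_pi_mul_I, mul_one]

theorem circlePoint_eq_iff {x : Plane} {r : ℝ} (hr : 0 < r) {θ φ : ℝ} :
    circlePoint x r θ = circlePoint x r φ ↔ ∃ n : ℤ, θ = φ + n * (2 * Real.pi) := by
  unfold circlePoint
  have hr' : (r : ℂ) ≠ 0 := by exact_mod_cast hr.ne'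
  rw [add_right_inj, planeToComplex.symm.injective.eq_iff, mul_right_inj' hr',
    Complex.exp_eq_exp_iff_exists_int]
  refine exists_congr fun n => ?_
  constructor
  · intro h
    have h2 : ((θ : ℂ)) = ((φ + n * (2 * Real.pi) : ℝ) : ℂ) := by
      apply mul_right_cancel₀ Complex.I_ne_zero
      rw [h]; push_cast; ring
    exact_mod_cast h2
  · rintro rfl
    push_cast; ring

/-- If the quotient is a real number s ≤ 0, then b and a lie on opposite sides of z (or b = z), so z
is on the segment. This makes the principal logarithm of the quotient continuous off the segment. -/
theorem div_mem_slitPlane {a b z : Plane} (h : z ∉ segment ℝ a b) :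
    planeToComplex (b - z) / planeToComplex (a - z) ∈ Complex.slitPlane := by
  rw [Complex.mem_slitPlane_iff_not_le_zero]
  intro hle
  apply h
  have ha : planeToComplex (a - z) ≠ 0 := by
    intro h0
    rw [map_eq_zero_iff _ planeToComplex.injective, sub_eq_zero] at h0
    exact h (h0 ▸ left_mem_segment ℝ a b)
  set q := planeToComplex (b - z) / planeToComplex (a - z) with hq
  rw [Complex.le_def] at hle
  have hq' : q = (q.re : ℂ) := by
    apply Complex.ext <;> simp [hle.2]
  have h1 : planeToComplex (b - z) = planeToComplex (q.re • (a - z)) := by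
    rw [map_smul, Complex.real_smul, ← hq', hq, div_mul_cancel₀ _ ha]
  have h2 := planeToComplex.injective h1
  have hs : q.re ≤ 0 := hle.1
  set s := q.re
  have hs1 : 0 < 1 - s := by linarith
  -- The weights come from solving b - z = s (a - z) for z.
  refine ⟨-s / (1 - s), 1 / (1 - s), div_nonneg (by linarith) hs1.le, by positivity, ?_, ?_⟩
  · field_simp
    ring
  · have hb : b = z + s • (a - z) := by rw [← h2]; abel
    rw [hb]
    have e1 : (1 / (1 - s)) = 1 + s / (1 - s) := by field_simp; ring
    have e2 : (s / (1 - s)) * (1 - s) = s := by field_simp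
    ext i
    simp only [PiLp.add_apply, PiLp.smul_apply, PiLp.sub_apply, smul_eq_mul]
    field_simp
    ring

/-! ### Continuous logarithms off polygonal curves -/

/-- A continuous branch of the logarithm of `(y - z) / (x - z)` off a polygonal curve
from `x` to `y`. -/
def IsWinding (x y : Plane) (e : Set Plane) (W : Plane → ℂ) : Prop :=
  ContinuousOn W eᶜ ∧
    ∀ z ∉ e, planeToComplex (x - z) * Complex.exp (W z) = planeToComplex (y - z)

/-- The quotients belonging to successive segments telescope, so the sum of their principal
logarithms serves. -/
theorem exists_isWinding_chain (p : ℕ → Plane) (n : ℕ) :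
    ∃ W, IsWinding (p 0) (p n) (⋃ i < n, segment ℝ (p i) (p (i + 1))) W := by
  induction n with
  | zero => exact ⟨fun _ => 0, continuousOn_const, fun z _ => by simp⟩
  | succ n ih =>
    obtain ⟨W, hW, hW'⟩ := ih
    have hsub : (⋃ i < n + 1, segment ℝ (p i) (p (i + 1))) =
        (⋃ i < n, segment ℝ (p i) (p (i + 1))) ∪ segment ℝ (p n) (p (n + 1)) :=
      biUnion_lt_succ _ _
    rw [hsub]
    refine ⟨fun z => W z + Complex.log (planeToComplex (p (n + 1) - z) / planeToComplex (p n - z)),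
      ?_, ?_⟩
    · refine (hW.mono (compl_subset_compl.2 subset_union_left)).add ?_
      intro z hz
      have hz' : z ∉ segment ℝ (p n) (p (n + 1)) := fun h => hz (Or.inr h)
      refine ContinuousAt.continuousWithinAt ?_
      have hne : planeToComplex (p n - z) ≠ 0 := by
        intro h0
        rw [map_eq_zero_iff _ planeToComplex.injective, sub_eq_zero] at h0
        exact hz' (h0 ▸ left_mem_segment ℝ _ _)
      refine ContinuousAt.clog ?_ (div_mem_slitPlane hz')
      have hc : Continuous planeToComplex := planeToComplex.continuous
      exact ContinuousAt.div (by fun_prop) (by fun_prop) hne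
    · intro z hz
      have hz' : z ∉ segment ℝ (p n) (p (n + 1)) := fun h => hz (Or.inr h)
      have hne : planeToComplex (p n - z) ≠ 0 := by
        intro h0
        rw [map_eq_zero_iff _ planeToComplex.injective, sub_eq_zero] at h0
        exact hz' (h0 ▸ left_mem_segment ℝ _ _)
      rw [Complex.exp_add, ← mul_assoc, hW' z fun h => hz (Or.inl h),
        Complex.exp_log (Complex.slitPlane_ne_zero (div_mem_slitPlane hz'))]
      field_simp

theorem IsArc.exists_isWinding {x y : Plane} {e : Set Plane} (h : IsArc x y e) :
    ∃ W, IsWinding x y e W := by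
  obtain ⟨n, p, -, rfl, rfl, -, -, rfl⟩ := h
  exact exists_isWinding_chain p n

theorem IsWinding.add {x y z : Plane} {e f : Set Plane} {W W' : Plane → ℂ}
    (h : IsWinding x y e W) (h' : IsWinding y z f W') :
    IsWinding x z (e ∪ f) (fun u => W u + W' u) := by
  refine ⟨(h.1.mono (compl_subset_compl.2 subset_union_left)).add
    (h'.1.mono (compl_subset_compl.2 subset_union_right)), fun u hu => ?_⟩
  rw [Complex.exp_add, ← mul_assoc, h.2 u fun hh => hu (Or.inl hh),
    h'.2 u fun hh => hu (Or.inr hh)]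

theorem isPreconnected_chain (p : ℕ → Plane) (n : ℕ) :
    IsPreconnected (⋃ i < n, segment ℝ (p i) (p (i + 1))) := by
  induction n with
  | zero => simpa using isPreconnected_empty
  | succ n ih =>
    rw [biUnion_lt_succ (fun i => segment ℝ (p i) (p (i + 1)))]
    rcases Nat.eq_zero_or_pos n with rfl | hn
    · simpa using (convex_segment (𝕜 := ℝ) (p 0) (p 1)).isPreconnected
    · refine ih.union (p n) ?_ (left_mem_segment ℝ _ _) (convex_segment _ _).isPreconnected
      simp only [mem_iUnion, exists_prop]
      refine ⟨n - 1, by omega, ?_⟩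
      rw [show n - 1 + 1 = n by omega]
      exact right_mem_segment ℝ _ _

theorem isClosed_segment_plane (a b : Plane) : IsClosed (segment ℝ a b) := by
  rw [segment_eq_image_lineMap]
  exact (isCompact_Icc.image AffineMap.lineMap_continuous).isClosed

namespace IsArc

variable {x y : Plane} {e : Set Plane}

theorem left_mem (h : IsArc x y e) : x ∈ e := by
  obtain ⟨n, p, hn, rfl, -, -, -, rfl⟩ := h
  exact mem_biUnion (show 0 ∈ {i | i < n} from hn) (left_mem_segment ℝ _ _)

theorem right_mem (h : IsArc x y e) : y ∈ e := h.symm.left_mem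

theorem isPreconnected (h : IsArc x y e) : IsPreconnected e := by
  obtain ⟨n, p, hn, rfl, -, -, -, rfl⟩ := h
  exact isPreconnected_chain p n

theorem isClosed (h : IsArc x y e) : IsClosed e := by
  obtain ⟨n, p, hn, rfl, -, -, -, rfl⟩ := h
  exact (Set.finite_lt_nat n).isClosed_biUnion fun i _ => isClosed_segment_plane _ _

end IsArc

theorem isArc_segment {a b : Plane} (h : a ≠ b) : IsArc a b (segment ℝ a b) := by
  refine ⟨1, fun i => if i = 0 then a else b, by norm_num, by simp, by simp, ?_, ?_, ?_⟩
  · intro i hi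
    obtain rfl : i = 0 := by omega
    simpa using h
  · intro i j hij hj
    omega
  · simp

theorem exists_mem_segment_dist {a b : Plane} {r : ℝ} (h0 : 0 ≤ r) (hr : r ≤ dist a b) :
    ∃ z ∈ segment ℝ a b, dist z a = r := by
  rcases eq_or_ne a b with rfl | hab
  · rw [dist_self] at hr
    exact ⟨a, left_mem_segment ℝ _ _, by rw [dist_self]; linarith⟩
  · have hd : 0 < dist a b := dist_pos.2 hab
    refine ⟨AffineMap.lineMap a b (r / dist a b), ?_, ?_⟩
    · rw [segment_eq_image_lineMap]
      exact ⟨_, ⟨by positivity, (div_le_one hd).2 hr⟩, rfl⟩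
    · rw [dist_lineMap_left, Real.norm_of_nonneg (by positivity)]
      field_simp

/-- Near its end point `x`, an arc is a ray. -/
theorem IsArc.exists_angle {x y : Plane} {e : Set Plane} (h : IsArc x y e) :
    ∃ α : ℝ, ∃ ε > 0, ∀ r, 0 < r → r < ε → e ∩ Metric.sphere x r = {circlePoint x r α} ∧
      ∃ K ⊆ e \ {x}, IsPreconnected K ∧ circlePoint x r α ∈ K ∧ y ∈ K := by
  obtain ⟨n, p, hn, rfl, rfl, hne, hint, rfl⟩ := h
  -- The segments after the first form a closed set missing the end point, hence missing a ball
  -- around it; in that ball only the first segment is seen.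
  set F : Set Plane := ⋃ i ∈ {i | 1 ≤ i ∧ i < n}, segment ℝ (p i) (p (i + 1)) with hF
  have hFc : IsClosed F := by
    refine Set.Finite.isClosed_biUnion ?_ fun i _ => isClosed_segment_plane _ _
    exact (Set.finite_lt_nat n).subset fun i hi => hi.2
  have h01 := hne 0 hn
  have hxF : p 0 ∉ F := by
    simp only [hF, mem_iUnion, exists_prop, not_exists, not_and]
    rintro i ⟨hi1, hi2⟩ hz
    obtain ⟨rfl, h2⟩ := hint 0 i hi1 hi2 (p 0) ⟨left_mem_segment ℝ _ _, hz⟩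
    exact h01 h2
  obtain ⟨ε, hε, hball⟩ := Metric.isOpen_iff.1 hFc.isOpen_compl (p 0) hxF
  set L := dist (p 0) (p 1) with hL
  have hLpos : 0 < L := dist_pos.2 h01
  refine ⟨(planeToComplex (p 1 - p 0)).arg, min ε L, lt_min hε hLpos, fun r hr0 hr => ?_⟩
  have hrε := hr.trans_le (min_le_left _ _)
  have hrL := hr.trans_le (min_le_right _ _)
  have hseg : ∀ t : ℝ, 0 ≤ t → dist (AffineMap.lineMap (p 0) (p 1) t) (p 0) = t * L := by
    intro t ht
    rw [dist_lineMap_left, Real.norm_of_nonneg ht]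
  have hc : circlePoint (p 0) r (planeToComplex (p 1 - p 0)).arg =
      AffineMap.lineMap (p 0) (p 1) (r / L) := by
    have hn1 : ‖planeToComplex (p 1 - p 0)‖ = L := by
      rw [LinearIsometryEquiv.norm_map, ← dist_eq_norm, dist_comm]
    have h1 := Complex.norm_mul_exp_arg_mul_I (planeToComplex (p 1 - p 0))
    rw [hn1] at h1
    have h2 : (r : ℂ) * Complex.exp ((planeToComplex (p 1 - p 0)).arg * Complex.I) =
        (r / L) • planeToComplex (p 1 - p 0) := by
      rw [Complex.real_smul, ← h1]
      have : (L : ℂ) ≠ 0 := by exact_mod_cast hLpos.ne'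
      push_cast
      rw [h1]
      field_simp
      linear_combination (r : ℂ) * h1
    rw [circlePoint, h2, map_smul, LinearIsometryEquiv.symm_apply_apply, AffineMap.lineMap_apply]
    simp [add_comm]
  have hcr : 0 < r / L := by positivity
  have hcr1 : r / L ≤ 1 := (div_le_one hLpos).2 hrL.le
  set c := circlePoint (p 0) r (planeToComplex (p 1 - p 0)).arg with hcdef
  have hcmem : c ∈ segment ℝ (p 0) (p 1) := by
    rw [segment_eq_image_lineMap]
    exact ⟨r / L, ⟨hcr.le, hcr1⟩, hc.symm⟩
  refine ⟨?_, ?_⟩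
  · ext z
    simp only [mem_inter_iff, mem_iUnion, exists_prop, Metric.mem_sphere, mem_singleton_iff]
    constructor
    · rintro ⟨⟨i, hi, hz⟩, hd⟩
      rcases Nat.eq_zero_or_pos i with rfl | hi0
      · rw [segment_eq_image_lineMap] at hz
        obtain ⟨t, ht, rfl⟩ := hz
        rw [zero_add, hseg t ht.1] at hd
        rw [hc, ← hd, mul_div_cancel_right₀ _ hLpos.ne']
      · exfalso
        refine hball (show z ∈ Metric.ball (p 0) ε by rw [Metric.mem_ball, hd]; exact hrε) ?_
        exact mem_biUnion (show i ∈ {i | 1 ≤ i ∧ i < n} from ⟨hi0, hi⟩) hz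
    · rintro rfl
      exact ⟨⟨0, hn, hcmem⟩, dist_circlePoint _ hr0.le _⟩
  -- Starting the chain at the point on the circle instead of the end point gives the rest of the
  -- arc.
  · set q : ℕ → Plane := Function.update p 0 c with hq
    have hq0 : q 0 = c := by simp [hq]
    have hqs : ∀ i, q (i + 1) = p (i + 1) := fun i => by simp [hq]
    refine ⟨⋃ i < n, segment ℝ (q i) (q (i + 1)), ?_, isPreconnected_chain q n, ?_, ?_⟩
    · intro z hz
      simp only [mem_iUnion, exists_prop] at hz
      obtain ⟨i, hi, hz⟩ := hz
      rcases i with _ | i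
      · rw [hq0, hqs, zero_add] at hz
        refine ⟨mem_biUnion (show 0 ∈ {i | i < n} from hn)
          ((convex_segment _ _).segment_subset hcmem (right_mem_segment ℝ _ _) hz), ?_⟩
        rintro rfl
        rw [hc, segment_eq_image_lineMap] at hz
        obtain ⟨t, ht, hz⟩ := hz
        have : AffineMap.lineMap (AffineMap.lineMap (p 0) (p 1) (r / L)) (p 1) t =
            AffineMap.lineMap (p 0) (p 1) (r / L + t * (1 - r / L)) := by
          simp only [AffineMap.lineMap_apply, vsub_eq_sub, vadd_eq_add]
          module
        rw [this] at hz
        have h0 : 0 ≤ t * (1 - r / L) := mul_nonneg ht.1 (by linarith)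
        have := hseg (r / L + t * (1 - r / L)) (by linarith)
        rw [hz, dist_self] at this
        have hpos : 0 < (r / L + t * (1 - r / L)) * L := mul_pos (by linarith) hLpos
        linarith
      · rw [hqs, hqs] at hz
        refine ⟨mem_biUnion (show i + 1 ∈ {i | i < n} from hi) hz, ?_⟩
        rintro rfl
        exact hxF (mem_biUnion (show i + 1 ∈ {i | 1 ≤ i ∧ i < n} from ⟨by omega, hi⟩) hz)
    · exact mem_biUnion (show 0 ∈ {i | i < n} from hn) (hq0 ▸ left_mem_segment ℝ _ _)
    · refine mem_biUnion (show n - 1 ∈ {i | i < n} from by simp; omega) ?_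
      rw [hqs, show n - 1 + 1 = n by omega]
      exact right_mem_segment ℝ _ _

/-- The end points of an arc are determined by its point set. -/
theorem IsArc.left_eq_or {x y x' y' : Plane} {e : Set Plane} (h : IsArc x y e)
    (h' : IsArc x' y' e) : x = x' ∨ x = y' := by
  obtain ⟨α, ε, hε, hloc⟩ := h.exists_angle
  have huniq : ∀ r, 0 < r → r < ε → ∀ z ∈ e, ∀ z' ∈ e, dist z x = r → dist z' x = r → z = z' := by
    intro r h0 h1 z hz z' hz' hd hd'
    have hs := (hloc r h0 h1).1
    have e1 : z ∈ e ∩ Metric.sphere x r := ⟨hz, hd⟩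
    have e2 : z' ∈ e ∩ Metric.sphere x r := ⟨hz', hd'⟩
    rw [hs, mem_singleton_iff] at e1 e2
    rw [e1, e2]
  -- Small circles around an end point meet the arc only once, so two segments of the arc issuing
  -- from x must overlap. Any other point of the arc has two branches that do not.
  have key : ∀ a b : Plane, a ≠ x → b ≠ x → segment ℝ x a ⊆ e → segment ℝ x b ⊆ e →
      ∃ z, z ≠ x ∧ z ∈ segment ℝ x a ∧ z ∈ segment ℝ x b := by
    intro a b ha hb hae hbe
    have ha' := dist_pos.2 ha.symm
    have hb' := dist_pos.2 hb.symm
    set r := min (ε / 2) (min (dist x a) (dist x b))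
    have hr0 : 0 < r := lt_min (by linarith) (lt_min ha' hb')
    have hrε : r < ε := (min_le_left _ _).trans_lt (by linarith)
    obtain ⟨z, hz, hzd⟩ := exists_mem_segment_dist (a := x) (b := a) hr0.le
      ((min_le_right _ _).trans (min_le_left _ _))
    obtain ⟨z', hz', hzd'⟩ := exists_mem_segment_dist (a := x) (b := b) hr0.le
      ((min_le_right _ _).trans (min_le_right _ _))
    obtain rfl := huniq r hr0 hrε z (hae hz) z' (hbe hz') hzd hzd'
    refine ⟨z, ?_, hz, hz'⟩
    rintro rfl
    rw [dist_self] at hzd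
    exact hr0.ne hzd
  have hxe := h.left_mem
  obtain ⟨n, p, hn, rfl, rfl, hne, hint, rfl⟩ := h'
  have hsub : ∀ i < n, segment ℝ (p i) (p (i + 1)) ⊆ ⋃ i < n, segment ℝ (p i) (p (i + 1)) :=
    fun i hi => subset_biUnion_of_mem (u := fun i => segment ℝ (p i) (p (i + 1)))
      (show i ∈ {i | i < n} from hi)
  have inner : ∀ i, i + 1 < n → x ≠ p (i + 1) := by
    rintro i hi rfl
    obtain ⟨z, hzx, hz1, hz2⟩ := key (p i) (p (i + 1 + 1)) (hne i (by omega)) (hne (i + 1) hi).symm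
      (by rw [segment_symm]; exact hsub i (by omega)) (hsub (i + 1) hi)
    rw [segment_symm] at hz1
    exact hzx (hint i (i + 1) (by omega) hi z ⟨hz1, hz2⟩).2
  simp only [mem_iUnion, exists_prop] at hxe
  obtain ⟨i, hi, hx⟩ := hxe
  by_contra! hcon
  have h1 : x ≠ p i := by
    rcases i with _ | i
    · exact hcon.1
    · exact inner i hi
  have h2 : x ≠ p (i + 1) := by
    rcases Nat.lt_or_ge (i + 1) n with h | h
    · exact inner i h
    · rw [show i + 1 = n by omega]; exact hcon.2
  -- Now x is strictly inside a segment, and the two halves of that segment are the non-overlapping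
  -- branches.
  obtain ⟨z, hzx, hz1, hz2⟩ := key (p i) (p (i + 1)) h1.symm h2.symm
    (((convex_segment _ _).segment_subset hx (left_mem_segment ℝ _ _)).trans (hsub i hi))
    (((convex_segment _ _).segment_subset hx (right_mem_segment ℝ _ _)).trans (hsub i hi))
  rw [segment_eq_image_lineMap] at hx hz1 hz2
  obtain ⟨t, ht, rfl⟩ := hx
  obtain ⟨s, hs, rfl⟩ := hz1
  obtain ⟨s', hs', hz2⟩ := hz2
  simp only [AffineMap.lineMap_apply, vsub_eq_sub, vadd_eq_add] at *
  have h0 : (s' * (1 - t) + s * t) • (p (i + 1) - p i) = 0 := by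
    have := sub_eq_zero.2 hz2
    rw [← this]
    module
  rcases smul_eq_zero.1 h0 with h0 | h0
  · have e1 : 0 ≤ s' * (1 - t) := mul_nonneg hs'.1 (by linarith [ht.2])
    have e2 : 0 ≤ s * t := mul_nonneg hs.1 ht.1
    have e3 : s * t = 0 := by linarith
    rcases mul_eq_zero.1 e3 with e4 | e4
    · apply hzx; rw [e4]; module
    · apply h1; rw [e4]; module
  · exact hne i hi (sub_eq_zero.1 h0).symm

/-! ## Windings and theta graphs -/

/-- The values of F differ by multiples of 2πi. By the intermediate value theorem, a change would
make the normalised imaginary part pass through ±1/2, which is not an integer. -/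
theorem IsPreconnected.eq_of_exp_eq {α : Type*} [TopologicalSpace α] {S : Set α}
    (hS : IsPreconnected S) {F : α → ℂ} (hF : ContinuousOn F S) {c : ℂ}
    (hc : ∀ s ∈ S, Complex.exp (F s) = c) {s t : α} (hs : s ∈ S) (ht : t ∈ S) : F s = F t := by
  have hint : ∀ u ∈ S, ∃ n : ℤ, F u = F s + n * (2 * Real.pi * Complex.I) := fun u hu =>
    Complex.exp_eq_exp_iff_exists_int.1 ((hc u hu).trans (hc s hs).symm)
  set f : α → ℝ := fun u => (F u - F s).im / (2 * Real.pi) with hf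
  have hpi := Real.two_pi_pos
  have hfint : ∀ u ∈ S, ∀ n : ℤ, F u = F s + n * (2 * Real.pi * Complex.I) → f u = n := by
    intro u hu n hn
    simp only [hf, hn, add_sub_cancel_left]
    simp
  have hfc : ContinuousOn f S := by
    refine ContinuousOn.div_const ?_ _
    exact Complex.continuous_im.comp_continuousOn (hF.sub continuousOn_const)
  have hfs : f s = 0 := by simp [hf]
  have hno : ∀ u ∈ S, ∀ m : ℤ, f u ≠ m + 1 / 2 := by
    intro u hu m h
    obtain ⟨n, hn⟩ := hint u hu
    rw [hfint u hu n hn] at h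
    have h2 : (2 * n : ℝ) = 2 * m + 1 := by linarith
    have h3 : 2 * n = 2 * m + 1 := by exact_mod_cast h2
    omega
  obtain ⟨n, hn⟩ := hint t ht
  have hft := hfint t ht n hn
  rcases lt_trichotomy n 0 with h | h | h
  · exfalso
    have h1 : (n : ℝ) ≤ -1 := by exact_mod_cast (by omega : n ≤ -1)
    obtain ⟨u, hu, hu'⟩ := hS.intermediate_value ht hs hfc
      (show (-1 / 2 : ℝ) ∈ Icc (f t) (f s) by rw [hft, hfs]; constructor <;> linarith)
    exact hno u hu (-1) (by rw [hu']; push_cast; norm_num)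
  · rw [hn, h]; simp
  · exfalso
    have h1 : (1 : ℝ) ≤ n := by exact_mod_cast (by omega : 1 ≤ n)
    obtain ⟨u, hu, hu'⟩ := hS.intermediate_value hs ht hfc
      (show (1 / 2 : ℝ) ∈ Icc (f s) (f t) by rw [hft, hfs]; constructor <;> linarith)
    exact hno u hu 0 (by rw [hu']; push_cast; norm_num)

/-- Both windings are logarithms of the same quotient (y - z)/(x - z), so their difference lies in
2πiℤ. It plays the role of the winding number of the closed curve formed by the two arcs. -/
theorem IsWinding.sub_eq_sub {x y : Plane} {A B S : Set Plane} {W W' : Plane → ℂ}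
    (h : IsWinding x y A W) (h' : IsWinding x y B W') (hS : IsPreconnected S) (hx : x ∉ S)
    (hA : Disjoint S A) (hB : Disjoint S B) {s t : Plane} (hs : s ∈ S) (ht : t ∈ S) :
    W s - W' s = W t - W' t := by
  refine hS.eq_of_exp_eq (F := fun z => W z - W' z) (c := 1) ?_ ?_ hs ht
  · exact (h.1.mono fun z hz => disjoint_left.1 hA hz).sub
      (h'.1.mono fun z hz => disjoint_left.1 hB hz)
  · intro z hz
    have h1 := h.2 z (disjoint_left.1 hA hz)
    have h2 := h'.2 z (disjoint_left.1 hB hz)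
    have hne : planeToComplex (x - z) ≠ 0 := by
      intro h0
      rw [map_eq_zero_iff _ planeToComplex.injective, sub_eq_zero] at h0
      exact hx (h0 ▸ hz)
    rw [Complex.exp_sub, mul_left_cancel₀ hne (h1.trans h2.symm), div_self (Complex.exp_ne_zero _)]

/-- On a small circle around `x`, a winding decreases with the angle. -/
theorem IsWinding.exists_eq_on_circle {x y : Plane} {A : Set Plane} {W : Plane → ℂ} {r α : ℝ}
    (h : IsWinding x y A W) (hr : 0 < r) (hry : r < dist x y)
    (hA : A ∩ Metric.sphere x r ⊆ {circlePoint x r α}) :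
    ∃ c : ℂ, ∀ θ ∈ Ioo α (α + 2 * Real.pi), W (circlePoint x r θ) =
      Complex.log (planeToComplex (y - circlePoint x r θ) / planeToComplex (y - x)) + c
        - θ * Complex.I := by
  have hyx : planeToComplex (y - x) ≠ 0 := by
    intro h0
    rw [map_eq_zero_iff _ planeToComplex.injective, sub_eq_zero] at h0
    rw [h0, dist_self] at hry
    linarith
  -- The quotient is 1 minus a number of modulus r / |x - y| < 1, so its real part is positive.
  have hslit : ∀ θ, planeToComplex (y - circlePoint x r θ) / planeToComplex (y - x) ∈
      Complex.slitPlane := by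
    intro θ
    have e1 : planeToComplex (y - circlePoint x r θ) =
        planeToComplex (y - x) - planeToComplex (circlePoint x r θ - x) := by
      rw [← map_sub]; congr 1; abel
    rw [e1, sub_div, div_self hyx, Complex.mem_slitPlane_iff]
    left
    have hn : ‖planeToComplex (circlePoint x r θ - x) / planeToComplex (y - x)‖ < 1 := by
      rw [norm_div, LinearIsometryEquiv.norm_map, LinearIsometryEquiv.norm_map, ← dist_eq_norm,
        ← dist_eq_norm, dist_circlePoint x hr.le, dist_comm y x]
      exact (div_lt_one (hr.trans hry)).2 hry
    have := (Complex.abs_re_le_norm _).trans_lt hn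
    rw [abs_lt] at this
    simp only [Complex.sub_re, Complex.one_re]
    linarith
  have hoff : ∀ θ ∈ Ioo α (α + 2 * Real.pi), circlePoint x r θ ∉ A := by
    intro θ hθ hmem
    have h1 := hA ⟨hmem, dist_circlePoint x hr.le θ⟩
    obtain ⟨n, hn⟩ := (circlePoint_eq_iff hr).1 h1
    have hpi := Real.two_pi_pos
    have h2 : (0 : ℝ) < n := by
      by_contra! hcon
      nlinarith [hθ.1]
    have h3 : (n : ℝ) < 1 := by
      by_contra! hcon
      nlinarith [hθ.2]
    have h4 : 0 < n := by exact_mod_cast h2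
    have h5 : n < 1 := by exact_mod_cast h3
    omega
  have hcp := continuous_circlePoint x r
  have hιc : Continuous planeToComplex := planeToComplex.continuous
  -- On the circle x - z = -r exp(iθ), so adding iθ and removing the logarithm of y - z leaves a
  -- function with constant exponential.
  set F : ℝ → ℂ := fun θ => W (circlePoint x r θ) + θ * Complex.I -
    Complex.log (planeToComplex (y - circlePoint x r θ) / planeToComplex (y - x)) with hF
  have hFc : ContinuousOn F (Ioo α (α + 2 * Real.pi)) := by
    refine ContinuousOn.sub (ContinuousOn.add ?_ (by fun_prop)) ?_
    · exact h.1.comp hcp.continuousOn hoff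
    · refine ContinuousOn.clog ?_ fun θ _ => hslit θ
      exact (by fun_prop : Continuous fun θ =>
        planeToComplex (y - circlePoint x r θ) / planeToComplex (y - x)).continuousOn
  have hFe : ∀ θ ∈ Ioo α (α + 2 * Real.pi), Complex.exp (F θ) = -planeToComplex (y - x) / r := by
    intro θ hθ
    have h1 := h.2 _ (hoff θ hθ)
    have h2 : planeToComplex (x - circlePoint x r θ) = -(r * Complex.exp (θ * Complex.I)) := by
      rw [← planeToComplex_circlePoint_sub x r θ, ← map_neg, neg_sub]
    have h3 := Complex.slitPlane_ne_zero (hslit θ)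
    have h4 : planeToComplex (y - circlePoint x r θ) ≠ 0 := fun h0 => h3 (by rw [h0, zero_div])
    have hr' : (r : ℂ) ≠ 0 := by exact_mod_cast hr.ne'
    rw [hF]
    simp only
    rw [Complex.exp_sub, Complex.exp_add, Complex.exp_log h3]
    rw [h2] at h1
    field_simp
    rw [← h1]
    ring
  have hpi := Real.two_pi_pos
  refine ⟨F (α + Real.pi), fun θ hθ => ?_⟩
  have := (isPreconnected_Ioo).eq_of_exp_eq hFc hFe hθ
    (show α + Real.pi ∈ Ioo α (α + 2 * Real.pi) by constructor <;> linarith)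
  rw [← this, hF]
  ring

theorem exists_angle_in (x : Plane) {r : ℝ} (hr : 0 < r) (α β : ℝ) :
    ∃ γ ∈ Ico α (α + 2 * Real.pi), circlePoint x r γ = circlePoint x r β := by
  refine ⟨toIcoMod Real.two_pi_pos α β, toIcoMod_mem_Ico _ _ _, ?_⟩
  rw [circlePoint_eq_iff hr]
  refine ⟨-toIcoDiv Real.two_pi_pos α β, ?_⟩
  have := toIcoMod_add_toIcoDiv_zsmul Real.two_pi_pos α β
  rw [zsmul_eq_mul] at this
  push_cast
  linarith

/-- Each winding has the form (common term) + constant - iθ, with θ measured from the direction of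
its own arc. In the cyclic sum the common terms and the constants cancel. The two windings at α use
the same lift of the angle, as do those at γ; at β the lifts used for C and A differ by 2π, which
leaves -2πi. -/
theorem theta_ne_zero_aux {x y : Plane} {A B C : Set Plane} {WA WB WC : Plane → ℂ} {r α β γ : ℝ}
    (hA : IsWinding x y A WA) (hB : IsWinding x y B WB) (hC : IsWinding x y C WC)
    (hr : 0 < r) (hry : r < dist x y)
    (hAs : A ∩ Metric.sphere x r ⊆ {circlePoint x r α})
    (hBs : B ∩ Metric.sphere x r ⊆ {circlePoint x r β})
    (hCs : C ∩ Metric.sphere x r ⊆ {circlePoint x r γ})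
    (hαβ : α < β) (hβγ : β < γ) (hγα : γ < α + 2 * Real.pi) :
    (WB (circlePoint x r α) - WC (circlePoint x r α)) +
      (WC (circlePoint x r β) - WA (circlePoint x r β)) +
      (WA (circlePoint x r γ) - WB (circlePoint x r γ)) ≠ 0 := by
  obtain ⟨a, ha⟩ := hA.exists_eq_on_circle hr hry hAs
  obtain ⟨b, hb⟩ := hB.exists_eq_on_circle hr hry hBs
  obtain ⟨c, hc⟩ := hC.exists_eq_on_circle hr hry hCs
  have h1 := hb (α + 2 * Real.pi) ⟨by linarith, by linarith⟩
  have h2 := hc (α + 2 * Real.pi) ⟨by linarith, by linarith⟩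
  have h3 := hc (β + 2 * Real.pi) ⟨by linarith, by linarith⟩
  have h4 := ha β ⟨by linarith, by linarith⟩
  have h5 := ha γ ⟨by linarith, by linarith⟩
  have h6 := hb γ ⟨by linarith, by linarith⟩
  rw [circlePoint_add_two_pi] at h1 h2 h3
  rw [h1, h2, h3, h4, h5, h6]
  have : -(2 * Real.pi * Complex.I) ≠ 0 := neg_ne_zero.2 Complex.two_pi_I_ne_zero
  convert this using 1
  push_cast
  ring

/-- Of three arcs from `x` to `y` that leave `x` in distinct directions, seen near `x`, exactly one
lies between the two others. -/
theorem theta_ne_zero {x y : Plane} {A B C : Set Plane} {WA WB WC : Plane → ℂ} {r α β γ : ℝ}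
    (hA : IsWinding x y A WA) (hB : IsWinding x y B WB) (hC : IsWinding x y C WC)
    (hr : 0 < r) (hry : r < dist x y)
    (hAs : A ∩ Metric.sphere x r ⊆ {circlePoint x r α})
    (hBs : B ∩ Metric.sphere x r ⊆ {circlePoint x r β})
    (hCs : C ∩ Metric.sphere x r ⊆ {circlePoint x r γ})
    (hab : circlePoint x r α ≠ circlePoint x r β) (hbc : circlePoint x r β ≠ circlePoint x r γ)
    (hac : circlePoint x r α ≠ circlePoint x r γ) :
    (WB (circlePoint x r α) - WC (circlePoint x r α)) +
      (WC (circlePoint x r β) - WA (circlePoint x r β)) +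
      (WA (circlePoint x r γ) - WB (circlePoint x r γ)) ≠ 0 := by
  obtain ⟨α', hα, hα'⟩ := exists_angle_in x hr 0 α
  obtain ⟨β', hβ, hβ'⟩ := exists_angle_in x hr 0 β
  obtain ⟨γ', hγ, hγ'⟩ := exists_angle_in x hr 0 γ
  rw [← hα', ← hβ', ← hγ']
  rw [← hα'] at hAs hab hac
  rw [← hβ'] at hBs hab hbc
  rw [← hγ'] at hCs hbc hac
  rw [zero_add] at hα hβ hγ
  have hab' : α' ≠ β' := fun h => hab (by rw [h])
  have hbc' : β' ≠ γ' := fun h => hbc (by rw [h])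
  have hac' : α' ≠ γ' := fun h => hac (by rw [h])
  intro h0
  -- Two of the eight sign patterns are contradictory; the other six are the orders of the angles,
  -- and an odd rearrangement of the arcs only changes the sign of the sum.
  rcases lt_or_gt_of_ne hab' with h1 | h1 <;> rcases lt_or_gt_of_ne hbc' with h2 | h2 <;>
    rcases lt_or_gt_of_ne hac' with h3 | h3
  · exact theta_ne_zero_aux hA hB hC hr hry hAs hBs hCs h1 h2 (by linarith [hγ.2, hα.1]) h0
  · linarith
  · exact theta_ne_zero_aux hA hC hB hr hry hAs hCs hBs h3 h2 (by linarith [hβ.2, hα.1])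
      (by linear_combination -h0)
  · exact theta_ne_zero_aux hC hA hB hr hry hCs hAs hBs h3 h1 (by linarith [hβ.2, hγ.1])
      (by linear_combination h0)
  · exact theta_ne_zero_aux hB hA hC hr hry hBs hAs hCs h1 h3 (by linarith [hγ.2, hβ.1])
      (by linear_combination -h0)
  · exact theta_ne_zero_aux hB hC hA hr hry hBs hCs hAs h2 h3 (by linarith [hα.2, hβ.1])
      (by linear_combination h0)
  · linarith
  · exact theta_ne_zero_aux hC hB hA hr hry hCs hBs hAs h2 h1 (by linarith [hα.2, hγ.1])
      (by linear_combination -h0)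

/-- Two points of a circle are the ends of an open arc of it through a given third point. -/
theorem exists_arc_through (x : Plane) {r : ℝ} (hr : 0 < r) {α β ζ : ℝ}
    (hαβ : circlePoint x r α ≠ circlePoint x r β) (hζα : circlePoint x r ζ ≠ circlePoint x r α)
    (hζβ : circlePoint x r ζ ≠ circlePoint x r β) :
    ∃ T : Set Plane, IsPreconnected T ∧ circlePoint x r ζ ∈ T ∧ T ⊆ Metric.sphere x r ∧
      circlePoint x r α ∉ T ∧ circlePoint x r β ∉ T ∧
      IsPreconnected (T ∪ {circlePoint x r α, circlePoint x r β}) := by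
  obtain ⟨b, hb, hb'⟩ := exists_angle_in x hr α β
  obtain ⟨z, hz, hz'⟩ := exists_angle_in x hr α ζ
  rw [← hb'] at hαβ hζβ ⊢
  rw [← hz'] at hζα hζβ ⊢
  have hb1 : α < b := lt_of_le_of_ne hb.1 fun h => hαβ (by rw [h])
  have hz1 : α < z := lt_of_le_of_ne hz.1 fun h => hζα (by rw [h])
  have hzb : z ≠ b := fun h => hζβ (by rw [h])
  have hcp := continuous_circlePoint x r
  have hpi := Real.two_pi_pos
  have hinj : ∀ s t : ℝ, s < t → t < s + 2 * Real.pi →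
      circlePoint x r s ≠ circlePoint x r t := by
    intro s t h1 h2 h
    obtain ⟨n, hn⟩ := (circlePoint_eq_iff hr).1 h.symm
    have h3 : (0 : ℝ) < n := by
      by_contra! hcon
      nlinarith
    have h4 : (n : ℝ) < 1 := by
      by_contra! hcon
      nlinarith
    have h5 : 0 < n := by exact_mod_cast h3
    have h6 : n < 1 := by exact_mod_cast h4
    omega
  have main : ∀ s t : ℝ, s < t → IsPreconnected
      (circlePoint x r '' Ioo s t ∪ {circlePoint x r s, circlePoint x r t}) := by
    intro s t hst
    have : circlePoint x r '' Ioo s t ∪ {circlePoint x r s, circlePoint x r t} =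
        circlePoint x r '' Icc s t := by
      rw [← Ioo_union_both hst.le, image_union, image_pair]
    rw [this]
    exact isPreconnected_Icc.image _ hcp.continuousOn
  have hsph : ∀ s : Set ℝ, circlePoint x r '' s ⊆ Metric.sphere x r := by
    rintro s _ ⟨θ, -, rfl⟩
    exact dist_circlePoint x hr.le θ
  -- Of the two open arcs between the points at angles α and b, take the one containing the angle z.
  rcases lt_or_gt_of_ne hzb with h | h
  · refine ⟨circlePoint x r '' Ioo α b, isPreconnected_Ioo.image _ hcp.continuousOn,
      ⟨z, ⟨hz1, h⟩, rfl⟩, hsph _, ?_, ?_, main α b hb1⟩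
    · rintro ⟨θ, hθ, hθ'⟩
      exact hinj α θ hθ.1 (hθ.2.trans hb.2) hθ'.symm
    · rintro ⟨θ, hθ, hθ'⟩
      exact hinj θ b hθ.2 (by linarith [hθ.1, hb.2]) hθ'
  · refine ⟨circlePoint x r '' Ioo b (α + 2 * Real.pi), isPreconnected_Ioo.image _
      hcp.continuousOn, ⟨z, ⟨h, hz.2⟩, rfl⟩, hsph _, ?_, ?_, ?_⟩
    · rintro ⟨θ, hθ, hθ'⟩
      exact hinj α θ (by linarith [hθ.1]) hθ.2 hθ'.symm
    · rintro ⟨θ, hθ, hθ'⟩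
      exact hinj b θ hθ.1 (by linarith [hθ.2]) hθ'.symm
    · have := main b (α + 2 * Real.pi) hb.2
      rwa [circlePoint_add_two_pi, pair_comm] at this

/-! ## Paths of length two in plane graphs -/

theorem IsPreconnected.subset_interior_of_disjoint_frontier {α : Type*} [TopologicalSpace α]
    {S R : Set α} (hS : IsPreconnected S) (hd : Disjoint S (frontier R)) {a : α} (ha : a ∈ S)
    (haR : a ∈ R) : S ⊆ interior R := by
  have hcov : S ⊆ interior R ∪ (closure R)ᶜ := by
    intro z hz
    by_contra hcon
    simp only [mem_union, mem_compl_iff, not_or, not_not] at hcon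
    exact disjoint_left.1 hd hz ⟨hcon.2, hcon.1⟩
  refine hS.subset_left_of_subset_union isOpen_interior isClosed_closure.isOpen_compl ?_ hcov
    ⟨a, ha, ?_⟩
  · exact disjoint_compl_right.mono_left (interior_subset.trans subset_closure)
  · exact (hcov ha).resolve_right fun h => h (subset_closure haR)

theorem IsPreconnected.subset_compl_of_disjoint_frontier {α : Type*} [TopologicalSpace α]
    {S R : Set α} (hS : IsPreconnected S) (hd : Disjoint S (frontier R)) {a : α} (ha : a ∈ S)
    (haR : a ∉ R) : S ⊆ Rᶜ := by
  rw [← frontier_compl] at hd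
  exact (hS.subset_interior_of_disjoint_frontier hd ha haR).trans interior_subset

namespace PlaneGraph

variable {G : PlaneGraph}

/-- The structure only records some pair of end points for an edge; by `IsArc.left_eq_or` a point
set has no other pair, so adjacency is unambiguous. -/
theorem inter_verts_of_isArc {x y : Plane} {e : Set Plane} (he : e ∈ G.edges) (h : IsArc x y e) :
    e ∩ G.verts = {x, y} := by
  obtain ⟨x', -, y', -, h', hv⟩ := G.isArc_edges e he
  rw [hv]
  have h1 := h.left_eq_or h'
  have h2 := h.symm.left_eq_or h'
  have h3 := h.ne
  rcases h1 with rfl | rfl <;> rcases h2 with rfl | rfl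
  · exact absurd rfl h3
  · rfl
  · exact pair_comm _ _
  · exact absurd rfl h3

theorem exists_edge {x y : Plane} (h : G.graph.Adj x y) :
    ∃ e ∈ G.edges, IsArc x y e ∧ e ∩ G.verts = {x, y} := by
  obtain ⟨e, he, ha⟩ := h
  exact ⟨e, he, ha, inter_verts_of_isArc he ha⟩

theorem adj_left_mem {x y : Plane} (h : G.graph.Adj x y) : x ∈ G.verts := by
  obtain ⟨e, -, -, hv⟩ := exists_edge h
  exact (hv.symm.subset (by simp : x ∈ ({x, y} : Set Plane))).2

theorem adj_right_mem {x y : Plane} (h : G.graph.Adj x y) : y ∈ G.verts := adj_left_mem h.symm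

theorem edge_inter_subset {e f : Set Plane} (he : e ∈ G.edges) (hf : f ∈ G.edges)
    (h : e ∩ G.verts ≠ f ∩ G.verts) : e ∩ f ⊆ (e ∩ G.verts) ∩ (f ∩ G.verts) := by
  intro z hz
  have hv := G.noncrossing e he f hf (fun h' => h (by rw [h'])) hz
  exact ⟨⟨hz.1, hv⟩, hz.2, hv⟩

/-- The union `A` of the edges of a path `v, a, w`, with a winding `W` of `A`, which near `v` is a
ray in direction `α`. -/
structure IsPathArc (G : PlaneGraph) (v a w : Plane) (A : Set Plane) (W : Plane → ℂ) (α ε : ℝ) :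
    Prop where
  winding : IsWinding v w A W
  pos : 0 < ε
  sphere : ∀ r, 0 < r → r < ε → A ∩ Metric.sphere v r = {circlePoint v r α}
  conn : ∀ r, 0 < r → r < ε →
    ∃ K ⊆ A \ {v, w}, IsPreconnected K ∧ circlePoint v r α ∈ K ∧ a ∈ K
  edges : ∃ e ∈ G.edges, ∃ f ∈ G.edges, A = e ∪ f ∧ e ∩ G.verts = {v, a} ∧ f ∩ G.verts = {a, w}
  ne_left : a ≠ v
  ne_right : a ≠ w
  ne : v ≠ w

theorem exists_isPathArc {v a w : Plane} (hva : G.graph.Adj v a) (haw : G.graph.Adj a w)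
    (hvw : v ≠ w) : ∃ A W α ε, G.IsPathArc v a w A W α ε := by
  obtain ⟨e, he, hea, hev⟩ := exists_edge hva
  obtain ⟨f, hf, hfa, hfv⟩ := exists_edge haw
  obtain ⟨W, hW⟩ := hea.exists_isWinding
  obtain ⟨W', hW'⟩ := hfa.exists_isWinding
  obtain ⟨α, ε, hε, hloc⟩ := hea.exists_angle
  have hav := hva.ne'
  have haw' := haw.ne
  have hvf : v ∉ f := by
    intro h
    have := hfv.subset ⟨h, adj_left_mem hva⟩
    rcases this with h | h
    · exact hav h.symm
    · exact hvw h
  have hwe : w ∉ e := by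
    intro h
    have := hev.subset ⟨h, adj_right_mem haw⟩
    rcases this with h | h
    · exact hvw h.symm
    · exact haw' h.symm
  obtain ⟨δ, hδ, hball⟩ := Metric.isOpen_iff.1 hfa.isClosed.isOpen_compl v hvf
  refine ⟨e ∪ f, _, α, min ε δ, hW.add hW', lt_min hε hδ, ?_, ?_, ⟨e, he, f, hf, rfl, hev, hfv⟩,
    hav, haw', hvw⟩
  · intro r h0 hr
    rw [union_inter_distrib_right, (hloc r h0 (hr.trans_le (min_le_left _ _))).1,
      union_eq_left]
    rintro z ⟨hz, hz'⟩
    exact absurd hz (hball (show z ∈ Metric.ball v δ by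
      rw [Metric.mem_ball, Metric.mem_sphere.1 hz']; exact hr.trans_le (min_le_right _ _)))
  · intro r h0 hr
    obtain ⟨K, hK, hKc, h1, h2⟩ := (hloc r h0 (hr.trans_le (min_le_left _ _))).2
    refine ⟨K, fun z hz => ⟨Or.inl (hK hz).1, ?_⟩, hKc, h1, h2⟩
    rintro (h | h)
    · exact (hK hz).2 h
    · exact hwe (h ▸ (hK hz).1)

namespace IsPathArc

variable {v w a b c d : Plane} {A B C : Set Plane} {WA WB WC : Plane → ℂ} {α β γ ε δ η r : ℝ}

theorem inter_verts (hA : G.IsPathArc v a w A WA α ε) : A ∩ G.verts = {v, a, w} := by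
  obtain ⟨e, -, f, -, rfl, h1, h2⟩ := hA.edges
  rw [union_inter_distrib_right, h1, h2]
  ext; simp; tauto

theorem edge_inter_subset (hA : G.IsPathArc v a w A WA α ε) {g : Set Plane} (hg : g ∈ G.edges)
    (h1 : g ∩ G.verts ≠ {v, a}) (h2 : g ∩ G.verts ≠ {a, w}) : g ∩ A ⊆ G.verts := by
  obtain ⟨e, he, f, hf, rfl, he', hf'⟩ := hA.edges
  rintro z ⟨hz, hz' | hz'⟩
  · exact (PlaneGraph.edge_inter_subset hg he (by rwa [he']) ⟨hz, hz'⟩).1.2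
  · exact (PlaneGraph.edge_inter_subset hg hf (by rwa [hf']) ⟨hz, hz'⟩).1.2

theorem inter_subset (hA : G.IsPathArc v a w A WA α ε) (hB : G.IsPathArc v b w B WB β δ)
    (hab : a ≠ b) : A ∩ B ⊆ {v, w} := by
  rintro z ⟨hzA, hzB⟩
  have hzv : z ∈ G.verts := by
    obtain ⟨e, he, f, hf, rfl, he', hf'⟩ := hA.edges
    have hne : ∀ s t : Set Plane, a ∈ s → t ⊆ {v, b, w} → s ≠ t := by
      rintro s t hs ht rfl
      rcases ht hs with h | h | h
      · exact hA.ne_left h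
      · exact hab h
      · exact hA.ne_right h
    rcases hzA with h | h
    · refine hB.edge_inter_subset he ?_ ?_ ⟨h, hzB⟩ <;> rw [he'] <;>
        refine hne _ _ (by simp) ?_ <;> intro u <;> simp <;> tauto
    · refine hB.edge_inter_subset hf ?_ ?_ ⟨h, hzB⟩ <;> rw [hf'] <;>
        refine hne _ _ (by simp) ?_ <;> intro u <;> simp <;> tauto
  have h1 := hA.inter_verts.subset ⟨hzA, hzv⟩
  have h2 := hB.inter_verts.subset ⟨hzB, hzv⟩
  rcases h1 with h | h | h
  · exact Or.inl h
  · rcases h2 with h' | h' | h'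
    · exact Or.inl h'
    · exact absurd (h.symm.trans h') hab
    · exact Or.inr h'
  · exact Or.inr h

theorem disjoint_edge (hB : G.IsPathArc v b w B WB β δ) {g : Set Plane} (hg : g ∈ G.edges)
    (hgv : g ∩ G.verts = {a, d}) (ha : a ∉ ({v, b, w} : Set Plane))
    (hd : d ∉ ({v, b, w} : Set Plane)) : Disjoint g B := by
  rw [disjoint_left]
  intro z hz hzB
  have hne : ∀ t : Set Plane, t ⊆ {v, b, w} → g ∩ G.verts ≠ t := by
    intro t ht h
    exact ha (ht (h ▸ hgv ▸ by simp))
  have hzv : z ∈ G.verts := by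
    refine hB.edge_inter_subset hg (hne _ ?_) (hne _ ?_) ⟨hz, hzB⟩ <;> intro u <;> simp <;> tauto
  have h1 := hgv.subset ⟨hz, hzv⟩
  have h2 := hB.inter_verts.subset ⟨hzB, hzv⟩
  rcases h1 with rfl | rfl
  · exact ha h2
  · exact hd h2

theorem circlePoint_ne (hA : G.IsPathArc v a w A WA α ε) (hB : G.IsPathArc v b w B WB β δ)
    (hab : a ≠ b) (h0 : 0 < r) (hrA : r < ε) (hrB : r < δ) (hrw : r < dist v w) :
    circlePoint v r α ≠ circlePoint v r β := by
  intro h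
  have h1 : circlePoint v r α ∈ A := ((hA.sphere r h0 hrA).symm.subset rfl).1
  have h2 : circlePoint v r β ∈ B := ((hB.sphere r h0 hrB).symm.subset rfl).1
  rcases hA.inter_subset hB hab ⟨h1, h ▸ h2⟩ with h3 | h3
  · exact _root_.circlePoint_ne v h0 α h3
  · have := dist_circlePoint v h0.le α
    rw [h3, dist_comm] at this
    linarith

/-- The part of A from the small circle to a, followed by the edge ad, is connected and avoids B and
C. Along it the difference is carried from the circle to d. -/
theorem sub_eq_sub_of_adj (hA : G.IsPathArc v a w A WA α ε) (hB : G.IsPathArc v b w B WB β δ)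
    (hC : G.IsPathArc v c w C WC γ η) (hab : a ≠ b) (hac : a ≠ c) (had : G.graph.Adj a d)
    (hdb : d ∉ ({v, b, w} : Set Plane)) (hdc : d ∉ ({v, c, w} : Set Plane)) (h0 : 0 < r)
    (hr : r < ε) :
    WB (circlePoint v r α) - WC (circlePoint v r α) = WB d - WC d := by
  obtain ⟨K, hK, hKc, h1, h2⟩ := hA.conn r h0 hr
  obtain ⟨g, hg, hga, hgv⟩ := exists_edge had
  have hanb : a ∉ ({v, b, w} : Set Plane) := by
    simp [hA.ne_left, hab, hA.ne_right]
  have hanc : a ∉ ({v, c, w} : Set Plane) := by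
    simp [hA.ne_left, hac, hA.ne_right]
  have hgB := hB.disjoint_edge hg hgv hanb hdb
  have hgC := hC.disjoint_edge hg hgv hanc hdc
  have hKd : ∀ {b' : Plane} {B' : Set Plane} {W' : Plane → ℂ} {β' δ' : ℝ},
      G.IsPathArc v b' w B' W' β' δ' → a ≠ b' → Disjoint K B' := by
    intro b' B' W' β' δ' h hne
    rw [disjoint_left]
    intro z hz hz'
    exact (hK hz).2 (hA.inter_subset h hne ⟨(hK hz).1, hz'⟩)
  refine hB.winding.sub_eq_sub hC.winding (hKc.union a h2 hga.left_mem hga.isPreconnected) ?_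
    ((hKd hB hab).union_left hgB) ((hKd hC hac).union_left hgC) (Or.inl h1) (Or.inr hga.right_mem)
  rintro (h | h)
  · exact (hK h).2 (Or.inl rfl)
  · obtain ⟨e, -, f, -, rfl, he, -⟩ := hB.edges
    exact disjoint_left.1 hgB h (Or.inl (he.symm.subset (Or.inl rfl)).1)

end IsPathArc

/-- A plane graph does not contain `K₃,₃`. -/
theorem not_completeBipartite {v w d a b c : Plane} (hvw : v ≠ w) (hdv : d ≠ v) (hdw : d ≠ w)
    (hab : a ≠ b) (hbc : b ≠ c) (hac : a ≠ c)
    (hva : G.graph.Adj v a) (hvb : G.graph.Adj v b) (hvc : G.graph.Adj v c)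
    (hwa : G.graph.Adj w a) (hwb : G.graph.Adj w b) (hwc : G.graph.Adj w c)
    (hda : G.graph.Adj d a) (hdb : G.graph.Adj d b) (hdc : G.graph.Adj d c) : False := by
  obtain ⟨A, WA, α, ε₁, hA⟩ := exists_isPathArc hva hwa.symm hvw
  obtain ⟨B, WB, β, ε₂, hB⟩ := exists_isPathArc hvb hwb.symm hvw
  obtain ⟨C, WC, γ, ε₃, hC⟩ := exists_isPathArc hvc hwc.symm hvw
  obtain ⟨r, h0, hr⟩ := exists_between
    (lt_min (dist_pos.2 hvw) (lt_min hA.pos (lt_min hB.pos hC.pos)))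
  simp only [lt_min_iff] at hr
  obtain ⟨hrw, hr1, hr2, hr3⟩ := hr
  have hd : ∀ x, G.graph.Adj d x → d ∉ ({v, x, w} : Set Plane) := by
    intro x hx
    simp [hdv, hx.ne, hdw]
  refine theta_ne_zero hA.winding hB.winding hC.winding h0 hrw (hA.sphere r h0 hr1).subset
    (hB.sphere r h0 hr2).subset (hC.sphere r h0 hr3).subset
    (hA.circlePoint_ne hB hab h0 hr1 hr2 hrw) (hB.circlePoint_ne hC hbc h0 hr2 hr3 hrw)
    (hA.circlePoint_ne hC hac h0 hr1 hr3 hrw) ?_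
  -- All three differences are moved to d, where the cyclic sum cancels identically.
  rw [hA.sub_eq_sub_of_adj hB hC hab hac hda.symm (hd b hdb) (hd c hdc) h0 hr1,
    hB.sub_eq_sub_of_adj hC hA hbc hab.symm hdb.symm (hd c hdc) (hd a hda) h0 hr2,
    hC.sub_eq_sub_of_adj hA hB hac.symm hbc.symm hdc.symm (hd a hda) (hd b hdb) h0 hr3]
  ring

/-- If `a, b, p, q` are common neighbours of `v` and `w`, the paths through `p` and `q` bound
a closed set `R`, and `a, b` lie inside `R`, then `p` is not adjacent to both `a` and `b`. -/
theorem not_adj_two_interior {v w p q a b : Plane} {R : Set Plane} (hR : IsClosed R)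
    {P Q : Set Plane} {WP WQ : Plane → ℂ} {π κ ε₁ ε₂ : ℝ} (hP : G.IsPathArc v p w P WP π ε₁)
    (hQ : G.IsPathArc v q w Q WQ κ ε₂) (hf : frontier R = P ∪ Q) (hpq : p ≠ q) (hab : a ≠ b)
    (ha : a ∈ interior R) (hb : b ∈ interior R)
    (hva : G.graph.Adj v a) (hvb : G.graph.Adj v b) (hwa : G.graph.Adj w a)
    (hwb : G.graph.Adj w b) (hpa : G.graph.Adj p a) (hpb : G.graph.Adj p b) : False := by
  have hvw := hP.ne
  obtain ⟨A, WA, α, ε₃, hA⟩ := exists_isPathArc hva hwa.symm hvw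
  obtain ⟨B, WB, β, ε₄, hB⟩ := exists_isPathArc hvb hwb.symm hvw
  have hvP : v ∈ P := (hP.inter_verts.symm.subset (by simp : v ∈ ({v, p, w} : Set Plane))).1
  have hpP : p ∈ P := (hP.inter_verts.symm.subset (by simp : p ∈ ({v, p, w} : Set Plane))).1
  have hqQ : q ∈ Q := (hQ.inter_verts.symm.subset (by simp : q ∈ ({v, q, w} : Set Plane))).1
  have hint : ∀ x ∈ interior R, x ∉ P ∧ x ∉ Q := by
    intro x hx
    have h1 : x ∉ frontier R := fun h => h.2 hx
    rw [hf] at h1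
    exact ⟨fun h => h1 (Or.inl h), fun h => h1 (Or.inr h)⟩
  have hap : a ≠ p := fun h => (hint a ha).1 (h ▸ hpP)
  have haq : a ≠ q := fun h => (hint a ha).2 (h ▸ hqQ)
  have hbp : b ≠ p := fun h => (hint b hb).1 (h ▸ hpP)
  have hbq : b ≠ q := fun h => (hint b hb).2 (h ▸ hqQ)
  have hfR : frontier R ⊆ R := hR.frontier_subset
  have hv : v ∈ closure Rᶜ := by
    have : v ∈ frontier R := hf ▸ Or.inl hvP
    rw [frontier_eq_closure_inter_closure] at this
    exact this.2
  -- As v is a boundary point, some z arbitrarily close to v lies outside R. Its distance to v is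
  -- taken as radius, so that the circle leaves R.
  obtain ⟨z, hzR, hz⟩ := Metric.mem_closure_iff.1 hv _ (lt_min (dist_pos.2 hvw)
    (lt_min hA.pos (lt_min hB.pos (lt_min hP.pos hQ.pos))))
  obtain ⟨r, hr⟩ : ∃ r, dist z v = r := ⟨_, rfl⟩
  rw [dist_comm, hr] at hz
  simp only [lt_min_iff] at hz
  obtain ⟨hrw, hrA, hrB, hrP, hrQ⟩ := hz
  have h0 : 0 < r := by
    rw [← hr, dist_pos]
    rintro rfl
    exact hzR (hfR (hf ▸ Or.inl hvP))
  have hzc := circlePoint_arg hr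
  set ζ := (planeToComplex (z - v)).arg
  have hpP' := (hP.sphere r h0 hrP).symm.subset rfl
  have hqQ' := (hQ.sphere r h0 hrQ).symm.subset rfl
  have hKsub : ∀ {x : Plane} {X : Set Plane} {WX : Plane → ℂ} {ξ ε : ℝ},
      G.IsPathArc v x w X WX ξ ε → x ∈ interior R → x ≠ p → x ≠ q → r < ε →
      circlePoint v r ξ ∈ interior R := by
    intro x X WX ξ ε hX hx hxp hxq hrε
    obtain ⟨K, hK, hKc, h1, h2⟩ := hX.conn r h0 hrε
    refine hKc.subset_interior_of_disjoint_frontier ?_ h2 (interior_subset hx) h1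
    rw [disjoint_left, hf]
    rintro u hu (hu' | hu')
    · exact (hK hu).2 (hX.inter_subset hP hxp ⟨(hK hu).1, hu'⟩)
    · exact (hK hu).2 (hX.inter_subset hQ hxq ⟨(hK hu).1, hu'⟩)
  have haI := hKsub hA ha hap haq hrA
  have hbI := hKsub hB hb hbp hbq hrB
  obtain ⟨T, hTc, hzT, hTs, hpT, hqT, hTc'⟩ := exists_arc_through v h0
    (α := π) (β := κ) (ζ := ζ) (hP.circlePoint_ne hQ hpq h0 hrP hrQ hrw)
    (by rw [hzc]; rintro rfl; exact hzR (hfR (hf ▸ Or.inl hpP'.1)))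
    (by rw [hzc]; rintro rfl; exact hzR (hfR (hf ▸ Or.inr hqQ'.1)))
  -- The arc of the circle through z between the rays of P and Q does not meet the frontier, so it
  -- stays outside R, where the paths through a and b cannot reach it.
  have hTR : T ⊆ Rᶜ := by
    refine hTc.subset_compl_of_disjoint_frontier ?_ hzT (by rwa [hzc])
    rw [disjoint_left, hf]
    rintro u hu (hu' | hu')
    · exact hpT ((hP.sphere r h0 hrP).subset ⟨hu', hTs hu⟩ ▸ hu)
    · exact hqT ((hQ.sphere r h0 hrQ).subset ⟨hu', hTs hu⟩ ▸ hu)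
  obtain ⟨K, hK, hKc, hK1, hK2⟩ := hP.conn r h0 hrP
  obtain ⟨L, hL, hLc, hL1, hL2⟩ := hQ.conn r h0 hrQ
  set T' := T ∪ {circlePoint v r π, circlePoint v r κ} with hT'
  -- This set leads from p back along P to the circle, around v outside R, and along Q to q. It
  -- replaces the missing edge pq: p then acts as the third vertex of a K₃,₃ with a, b, q.
  have hS : IsPreconnected (K ∪ T' ∪ L) := by
    refine IsPreconnected.union (circlePoint v r κ) ?_ hL1 ?_ hLc
    · right; right; right; rfl
    · exact hKc.union (circlePoint v r π) hK1 (Or.inr (Or.inl rfl)) hTc'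
  have hdis : ∀ {x : Plane} {X : Set Plane} {WX : Plane → ℂ} {ξ ε : ℝ},
      G.IsPathArc v x w X WX ξ ε → circlePoint v r ξ ∈ interior R → x ≠ p → x ≠ q → r < ε →
      Disjoint (K ∪ T' ∪ L) X := by
    intro x X WX ξ ε hX hx hxp hxq hrε
    have dK : Disjoint K X := by
      rw [disjoint_left]
      intro u hu hu'
      exact (hK hu).2 (hX.inter_subset hP hxp ⟨hu', (hK hu).1⟩)
    have dL : Disjoint L X := by
      rw [disjoint_left]
      intro u hu hu'
      exact (hL hu).2 (hX.inter_subset hQ hxq ⟨hu', (hL hu).1⟩)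
    refine (dK.union_left ?_).union_left dL
    rw [disjoint_left]
    rintro u (hu | rfl | rfl) hu'
    · exact hTR hu (interior_subset ((hX.sphere r h0 hrε).subset ⟨hu', hTs hu⟩ ▸ hx))
    · exact disjoint_left.1 dK hK1 hu'
    · exact disjoint_left.1 dL hL1 hu'
  have hvS : v ∉ K ∪ T' ∪ L := by
    rintro ((h | h | h | h) | h)
    · exact (hK h).2 (Or.inl rfl)
    · have := hTs h
      rw [Metric.mem_sphere, dist_self] at this
      exact h0.ne this
    · exact circlePoint_ne v h0 π h.symm
    · exact circlePoint_ne v h0 κ h.symm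
    · exact (hL h).2 (Or.inl rfl)
  have e3 := hA.winding.sub_eq_sub hB.winding hS hvS (hdis hA haI hap haq hrA)
    (hdis hB hbI hbp hbq hrB) (Or.inr hL1) (Or.inl (Or.inl hK2))
  have hp : ∀ x, p ≠ x → p ∉ ({v, x, w} : Set Plane) := by
    intro x hx
    simp [hP.ne_left, hx, hP.ne_right]
  refine theta_ne_zero hA.winding hB.winding hQ.winding h0 hrw (hA.sphere r h0 hrA).subset
    (hB.sphere r h0 hrB).subset (hQ.sphere r h0 hrQ).subset
    (hA.circlePoint_ne hB hab h0 hrA hrB hrw) (hB.circlePoint_ne hQ hbq h0 hrB hrQ hrw)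
    (hA.circlePoint_ne hQ haq h0 hrA hrQ hrw) ?_
  rw [hA.sub_eq_sub_of_adj hB hQ hab haq hpa.symm (hp b hbp.symm) (hp q hpq) h0 hrA,
    hB.sub_eq_sub_of_adj hQ hA hbq hab.symm hpb.symm (hp q hpq) (hp a hap.symm) h0 hrB, e3]
  ring

end PlaneGraph

/-! ## Simple regions -/

/-- A set `D` of at most three vertices that dominates six vertices, each of its elements at most
two, is not contained in the set of these vertices. -/
theorem SimpleGraph.not_subset_of_dominates_six {V : Type*} (H : SimpleGraph V) [DecidableEq V]
    [DecidableRel H.Adj] (J D : Finset V) (hdom : ∀ s ∈ J, ∃ d ∈ D, H.Adj s d)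
    (hdeg : ∀ d ∈ D, (J.filter (H.Adj d)).card ≤ 2) (hD : D.card ≤ 3) (hJ : 6 ≤ J.card) :
    J.card = 6 ∧ (∀ d ∈ D, (J.filter (H.Adj d)).card = 2) ∧ ¬ D ⊆ J := by
  -- Double counting of adjacent pairs gives 6 ≤ |J| ≤ sum ≤ 2|D| ≤ 6, so equality holds everywhere
  -- and each vertex of J has exactly one neighbour in D.
  have hcount : ∑ d ∈ D, (J.filter (H.Adj d)).card = ∑ s ∈ J, (D.filter (H.Adj s)).card := by
    have := Finset.sum_card_bipartiteAbove_eq_sum_card_bipartiteBelow (s := D) (t := J)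
      (fun d s => H.Adj d s)
    simpa [Finset.bipartiteAbove, Finset.bipartiteBelow, H.adj_comm] using this
  have hpos : ∀ s ∈ J, 1 ≤ (D.filter (H.Adj s)).card := by
    intro s hs
    obtain ⟨d, hd, hsd⟩ := hdom s hs
    exact Finset.card_pos.2 ⟨d, Finset.mem_filter.2 ⟨hd, hsd⟩⟩
  have hle : ∑ d ∈ D, (J.filter (H.Adj d)).card ≤ D.card * 2 := by
    rw [← smul_eq_mul]
    exact Finset.sum_le_card_nsmul D _ 2 hdeg
  have hge : J.card ≤ ∑ s ∈ J, (D.filter (H.Adj s)).card := by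
    simpa using Finset.card_nsmul_le_sum J _ 1 hpos
  have huniq : ∀ s ∈ J, ∀ d ∈ D, ∀ d' ∈ D, H.Adj s d → H.Adj s d' → d = d' := by
    intro s hs d hd d' hd' h h'
    by_contra hne
    have h2 : 1 < (D.filter (H.Adj s)).card := Finset.one_lt_card.2
      ⟨d, Finset.mem_filter.2 ⟨hd, h⟩, d', Finset.mem_filter.2 ⟨hd', h'⟩, hne⟩
    have : ∑ s ∈ J, 1 < ∑ s ∈ J, (D.filter (H.Adj s)).card := Finset.sum_lt_sum hpos ⟨s, hs, h2⟩
    simp only [Finset.sum_const, smul_eq_mul, mul_one] at this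
    omega
  refine ⟨by omega, ?_, ?_⟩
  · intro d hd
    by_contra hne
    have h2 := lt_of_le_of_ne (hdeg d hd) hne
    have : ∑ d ∈ D, (J.filter (H.Adj d)).card < ∑ d ∈ D, 2 := Finset.sum_lt_sum hdeg ⟨d, hd, h2⟩
    simp only [Finset.sum_const, smul_eq_mul] at this
    omega
  · intro hDJ
    obtain ⟨x, y, z, hxy, hxz, hyz, rfl⟩ := Finset.card_eq_three.1 (show D.card = 3 by omega)
    -- If D lies in J, adjacency on D is a perfect matching, impossible on three points: once s and
    -- d are matched, t has no partner.
    have key : ∀ s ∈ J, ∀ d ∈ J, ∀ t ∈ J, ({s, d, t} : Finset V) = {x, y, z} → s ≠ d → s ≠ t →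
        d ≠ t → H.Adj s d → False := by
      intro s hs d hd t ht he h1 h2 h3 hsd
      obtain ⟨u, hu, htu⟩ := hdom t ht
      rw [← he] at hu huniq
      simp only [Finset.mem_insert, Finset.mem_singleton] at hu
      rcases hu with rfl | rfl | rfl
      · exact h3 (huniq u hs d (by simp) t (by simp) hsd htu.symm)
      · exact h2 (huniq u hd s (by simp) t (by simp) hsd.symm htu.symm)
      · exact H.irrefl htu
    have hx : x ∈ J := hDJ (by simp)
    have hy : y ∈ J := hDJ (by simp)
    have hz : z ∈ J := hDJ (by simp)
    obtain ⟨u, hu, hxu⟩ := hdom x hx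
    simp only [Finset.mem_insert, Finset.mem_singleton] at hu
    rcases hu with rfl | rfl | rfl
    · exact H.irrefl hxu
    · exact key x hx u hy z hz rfl hxy hxz hyz hxu
    · exact key x hx u hz y hy (by rw [Finset.pair_comm]) hxz hxy hyz.symm hxu

namespace PlaneGraph

variable {G : PlaneGraph} {v w : Plane} {R : Set Plane}

theorem drawing_nil : G.drawing (SimpleGraph.Walk.nil : G.graph.Walk v v) = ∅ := by
  simp [drawing]

theorem drawing_cons {u : Plane} (h : G.graph.Adj v u) (P : G.graph.Walk u w) {e : Set Plane}
    (he : e ∈ G.edges) (hev : e ∩ G.verts = {v, u}) :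
    G.drawing (SimpleGraph.Walk.cons h P) = e ∪ G.drawing P := by
  obtain ⟨e', he', hea, hev'⟩ := exists_edge h
  obtain rfl := G.simple e he e' he' (hev.trans hev'.symm)
  ext z
  simp only [drawing, SimpleGraph.Walk.darts_cons, List.mem_cons, mem_ofPred, mem_union]
  constructor
  · rintro ⟨d, rfl | hd, f, hf, hfa, hz⟩
    · left
      rwa [G.simple e he f hf (hev.trans (inter_verts_of_isArc hf hfa).symm)]
    · exact Or.inr ⟨d, hd, f, hf, hfa, hz⟩
  · rintro (hz | ⟨d, hd, f, hf, hfa, hz⟩)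
    · exact ⟨_, Or.inl rfl, e, he, hea, hz⟩
    · exact ⟨d, Or.inr hd, f, hf, hfa, hz⟩

/-- A path consisting of a single edge gets the dummy middle vertex p = v, so both lengths are
treated alike. The last clause lets crossings with the path be reduced to crossings with an edge. -/
theorem exists_drawing_eq (hvw : v ≠ w) (P : G.graph.Walk v w) (hP : P.IsPath)
    (hl : P.length ≤ 2) :
    ∃ p, G.drawing P ∩ G.verts = {v, w, p} ∧
      (p = v ∨ ∃ W π ε, G.IsPathArc v p w (G.drawing P) W π ε) ∧
      ∀ z ∈ G.drawing P, ∃ f ∈ G.edges, z ∈ f ∧ f ⊆ G.drawing P := by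
  cases P with
  | nil => exact absurd rfl hvw
  | @cons _ u _ h P =>
    obtain ⟨e, he, hea, hev⟩ := exists_edge h
    rw [drawing_cons h P he hev]
    cases P with
    | nil =>
      refine ⟨v, ?_, Or.inl rfl, ?_⟩
      · rw [drawing_nil, union_empty, hev]
        ext; simp; tauto
      · rw [drawing_nil, union_empty]
        exact fun z hz => ⟨e, he, hz, subset_rfl⟩
    | @cons _ u' _ h' P =>
      cases P with
      | nil =>
        obtain ⟨A, W, α, ε, hA⟩ := exists_isPathArc h h' hvw
        obtain ⟨e₁, he₁, f₁, hf₁, rfl, h1, h2⟩ := hA.edges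
        obtain rfl := G.simple e he e₁ he₁ (hev.trans h1.symm)
        rw [drawing_cons h' _ hf₁ h2, drawing_nil, union_empty]
        refine ⟨u, ?_, Or.inr ⟨W, α, ε, hA⟩, ?_⟩
        · rw [hA.inter_verts, pair_comm]
        · rintro z (hz | hz)
          · exact ⟨e, he, hz, subset_union_left⟩
          · exact ⟨f₁, hf₁, hz, subset_union_right⟩
      | cons h'' P => simp at hl

namespace IsSimpleRegion

theorem exists_frontier_eq (hR : G.IsSimpleRegion v w R) :
    ∃ p q P Q, frontier R = P ∪ Q ∧ P ∩ G.verts = {v, w, p} ∧ Q ∩ G.verts = {v, w, q} ∧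
      (p = v ∨ ∃ W π ε, G.IsPathArc v p w P W π ε) ∧
      (q = v ∨ ∃ W π ε, G.IsPathArc v q w Q W π ε) ∧
      ∀ z ∈ frontier R, ∃ f ∈ G.edges, z ∈ f ∧ f ⊆ frontier R := by
  obtain ⟨hvw, -, ⟨P, Q, hP, hQ, hPl, hQl, hf⟩, -⟩ := hR
  obtain ⟨p, hp1, hp2, hp3⟩ := exists_drawing_eq hvw P hP hPl
  obtain ⟨q, hq1, hq2, hq3⟩ := exists_drawing_eq hvw Q hQ hQl
  refine ⟨p, q, _, _, hf, hp1, hq1, hp2, hq2, ?_⟩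
  rw [hf]
  rintro z (hz | hz)
  · obtain ⟨f, h1, h2, h3⟩ := hp3 z hz
    exact ⟨f, h1, h2, h3.trans subset_union_left⟩
  · obtain ⟨f, h1, h2, h3⟩ := hq3 z hz
    exact ⟨f, h1, h2, h3.trans subset_union_right⟩

theorem exists_frontier_inter (hR : G.IsSimpleRegion v w R) :
    ∃ p q, frontier R ∩ G.verts = {v, w, p, q} := by
  obtain ⟨p, q, P, Q, hf, hp, hq, -⟩ := hR.exists_frontier_eq
  refine ⟨p, q, ?_⟩
  rw [hf, union_inter_distrib_right, hp, hq]
  ext; simp; tauto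

theorem left_mem_frontier (hR : G.IsSimpleRegion v w R) : v ∈ frontier R ∩ G.verts := by
  obtain ⟨p, q, h⟩ := hR.exists_frontier_inter
  rw [h]; simp

theorem right_mem_frontier (hR : G.IsSimpleRegion v w R) : w ∈ frontier R ∩ G.verts := by
  obtain ⟨p, q, h⟩ := hR.exists_frontier_inter
  rw [h]; simp

theorem isClosed (hR : G.IsSimpleRegion v w R) : IsClosed R := hR.2.1

theorem left_mem (hR : G.IsSimpleRegion v w R) : v ∈ G.vertsIn R :=
  ⟨hR.left_mem_frontier.2, hR.isClosed.frontier_subset hR.left_mem_frontier.1⟩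

theorem right_mem (hR : G.IsSimpleRegion v w R) : w ∈ G.vertsIn R :=
  ⟨hR.right_mem_frontier.2, hR.isClosed.frontier_subset hR.right_mem_frontier.1⟩

theorem drawing_reverse {x y : Plane} (P : G.graph.Walk x y) :
    G.drawing P.reverse = G.drawing P := by
  ext z
  simp only [drawing, SimpleGraph.Walk.darts_reverse, List.mem_reverse, List.mem_map, mem_ofPred]
  constructor
  · rintro ⟨_, ⟨d, hd, rfl⟩, e, he, ha, hz⟩
    exact ⟨d, hd, e, he, ha.symm, hz⟩
  · rintro ⟨d, hd, e, he, ha, hz⟩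
    exact ⟨_, ⟨d, hd, rfl⟩, e, he, ha.symm, hz⟩

theorem symm (hR : G.IsSimpleRegion v w R) : G.IsSimpleRegion w v R := by
  obtain ⟨hvw, hc, ⟨P, Q, hP, hQ, hPl, hQl, hf⟩, h⟩ := hR
  refine ⟨hvw.symm, hc, ⟨P.reverse, Q.reverse, hP.reverse, hQ.reverse, by simpa, by simpa, ?_⟩, ?_⟩
  · rw [drawing_reverse, drawing_reverse, hf]
  · rwa [pair_comm, inter_comm]

/-- Edges do not leave a region from its interior. -/
theorem mem_of_adj_interior (hR : G.IsSimpleRegion v w R) {c u : Plane} (hc : c ∈ interior R)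
    (hcu : G.graph.Adj c u) : u ∈ R := by
  obtain ⟨e, he, hea, hev⟩ := exists_edge hcu
  obtain ⟨-, -, -, -, -, -, -, -, -, hedge⟩ := hR.exists_frontier_eq
  by_cases hd : Disjoint e (frontier R)
  · exact interior_subset (hea.isPreconnected.subset_interior_of_disjoint_frontier hd hea.left_mem
      (interior_subset hc) hea.right_mem)
  -- An edge can meet the boundary only in a vertex, here its other end u, since c is not on the
  -- boundary.
  · obtain ⟨z, hze, hz⟩ := not_disjoint_iff.1 hd
    obtain ⟨f, hf, hzf, hff⟩ := hedge z hz
    have hcf : c ∉ frontier R := fun h => h.2 hc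
    have hne : e ≠ f := by
      rintro rfl
      exact hcf (hff hea.left_mem)
    rcases hev.subset ⟨hze, G.noncrossing e he f hf hne ⟨hze, hzf⟩⟩ with h | h
    · exact absurd (h ▸ hz) hcf
    · exact hR.isClosed.frontier_subset ((show z = u from h) ▸ hz)

theorem adj_of_mem (hR : G.IsSimpleRegion v w R) {x : Plane} (hx : x ∈ G.vertsIn R) (hv : x ≠ v)
    (hw : x ≠ w) : G.graph.Adj v x ∧ G.graph.Adj w x :=
  hR.2.2.2 ⟨hx, by simp [hv, hw]⟩

theorem ne_of_mem_interior (hR : G.IsSimpleRegion v w R) {x : Plane} (hx : x ∈ interior R) :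
    x ≠ v ∧ x ≠ w := by
  constructor
  · rintro rfl
    exact hR.left_mem_frontier.1.2 hx
  · rintro rfl
    exact hR.right_mem_frontier.1.2 hx

theorem adj_of_mem_interior (hR : G.IsSimpleRegion v w R) {x : Plane}
    (hx : x ∈ G.verts ∩ interior R) : G.graph.Adj v x ∧ G.graph.Adj w x :=
  have h := hR.ne_of_mem_interior hx.2
  hR.adj_of_mem ⟨hx.1, interior_subset hx.2⟩ h.1 h.2

/-- Among the common neighbours in a region, none has three neighbours. -/
theorem not_three_adj (hR : G.IsSimpleRegion v w R) {d a b c : Plane}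
    (hdv : d ≠ v) (hdw : d ≠ w) (hab : a ≠ b) (hbc : b ≠ c) (hac : a ≠ c)
    (ha : a ∈ G.vertsIn R \ {v, w}) (hb : b ∈ G.vertsIn R \ {v, w})
    (hc : c ∈ G.vertsIn R \ {v, w}) (hda : G.graph.Adj d a) (hdb : G.graph.Adj d b)
    (hdc : G.graph.Adj d c) : False :=
  not_completeBipartite hR.1 hdv hdw hab hbc hac (hR.2.2.2 ha).1 (hR.2.2.2 hb).1 (hR.2.2.2 hc).1
    (hR.2.2.2 ha).2 (hR.2.2.2 hb).2 (hR.2.2.2 hc).2 hda hdb hdc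

theorem mem_nbhd (hR : G.IsSimpleRegion v w R) {x : Plane} (hx : x ∈ G.vertsIn R) (hv : x ≠ v)
    (hw : x ≠ w) : x ∈ G.graph.nbhd {v, w} :=
  ⟨by simp [hv, hw], v, by simp, (hR.adj_of_mem hx hv hw).1⟩

/-- All neighbours of an inner vertex are in R, and a vertex of R is v, w or a neighbour of both. -/
theorem not_mem_nbhd₁ (hR : G.IsSimpleRegion v w R) {x : Plane}
    (hx : x ∈ G.verts ∩ interior R) : x ∉ G.graph.nbhd₁ {v, w} := by
  rintro ⟨-, u, hu, hu'⟩
  apply hu'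
  have huR := hR.mem_of_adj_interior hx.2 hu
  by_cases h1 : u = v
  · exact Or.inr (Or.inl h1)
  by_cases h2 : u = w
  · exact Or.inr (Or.inr h2)
  exact Or.inl (hR.mem_nbhd ⟨adj_right_mem hu, huR⟩ h1 h2)

/-- Such a vertex is in N₂, so it has a neighbour in N₁. That neighbour is in R but not inside it,
as inner vertices are never in N₁. -/
theorem exists_adj_frontier (hR : G.IsSimpleRegion v w R) {x : Plane}
    (hx : x ∈ G.verts ∩ interior R) (hx3 : x ∉ G.graph.nbhd₃ {v, w}) :
    ∃ u ∈ G.verts ∩ frontier R, u ≠ v ∧ u ≠ w ∧ G.graph.Adj x u := by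
  have hne := hR.ne_of_mem_interior hx.2
  have hnb := hR.mem_nbhd ⟨hx.1, interior_subset hx.2⟩ hne.1 hne.2
  have hx1 := hR.not_mem_nbhd₁ hx
  have hx2 : x ∈ G.graph.nbhd₂ {v, w} := by
    by_contra h
    exact hx3 ⟨hnb, fun h' => h'.elim hx1 h⟩
  obtain ⟨-, u, hu, hu1⟩ := hx2
  have huR := hR.mem_of_adj_interior hx.2 hu
  have hun := hu1.1.1
  simp only [mem_insert_iff, mem_singleton_iff, not_or] at hun
  refine ⟨u, ⟨adj_right_mem hu, subset_closure huR, ?_⟩, hun.1, hun.2, hu⟩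
  intro h
  exact hR.not_mem_nbhd₁ ⟨adj_right_mem hu, h⟩ hu1

end IsSimpleRegion

theorem finite_vertsIn (G : PlaneGraph) (R : Set Plane) : (G.vertsIn R).Finite :=
  G.finite_verts.subset inter_subset_left

-- The counting core. If the boundary has two distinct vertices p, q besides v, w, at least 12 - 4
-- vertices are inside and at most one per boundary vertex is outside N₃. Otherwise at least 12 - 3
-- are inside and at most two are outside N₃, which leaves seven, already too many for three
-- dominating vertices.
open Classical in
theorem IsSimpleRegion.six_le_and_not_hasSmallTDS (hR : G.IsSimpleRegion v w R)
    (h12 : 12 ≤ (G.vertsIn R).ncard) :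
    6 ≤ (G.verts ∩ interior R ∩ G.graph.nbhd₃ {v, w}).ncard ∧ ¬ G.graph.HasSmallTDS v w := by
  obtain ⟨p, q, P, Q, hf, hPv, hQv, hp, hq, -⟩ := hR.exists_frontier_eq
  have hfv : frontier R ∩ G.verts = {v, w, p, q} := by
    rw [hf, union_inter_distrib_right, hPv, hQv]
    ext; simp; tauto
  have hfin : (G.verts ∩ interior R).Finite := G.finite_verts.subset inter_subset_left
  have hfinJ : (G.verts ∩ interior R ∩ G.graph.nbhd₃ {v, w}).Finite :=
    hfin.subset inter_subset_left
  set I := hfin.toFinset with hI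
  set J := hfinJ.toFinset with hJ
  have memI : ∀ x, x ∈ I ↔ x ∈ G.verts ∩ interior R := fun x => hfin.mem_toFinset
  have memJ : ∀ x, x ∈ J ↔ x ∈ G.verts ∩ interior R ∩ G.graph.nbhd₃ {v, w} :=
    fun x => hfinJ.mem_toFinset
  have hJI : J ⊆ I := fun x hx => (memI x).2 ((memJ x).1 hx).1
  have memX : ∀ x ∈ I, x ∈ G.vertsIn R \ {v, w} := by
    intro x hx
    rw [memI] at hx
    have := hR.ne_of_mem_interior hx.2
    exact ⟨⟨hx.1, interior_subset hx.2⟩, by simp [this.1, this.2]⟩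
  have split : ∀ x ∈ G.vertsIn R, x ∈ I ∨ x ∈ ({v, w, p, q} : Set Plane) := by
    rintro x ⟨hxv, hxR⟩
    by_cases h : x ∈ interior R
    · exact Or.inl ((memI x).2 ⟨hxv, h⟩)
    · exact Or.inr (hfv.subset ⟨⟨subset_closure hxR, h⟩, hxv⟩)
  have pmem : p ∈ G.vertsIn R ∧ p ∉ interior R := by
    have := hfv.symm.subset (by simp : p ∈ ({v, w, p, q} : Set Plane))
    exact ⟨⟨this.2, hR.isClosed.frontier_subset this.1⟩, this.1.2⟩
  have qmem : q ∈ G.vertsIn R ∧ q ∉ interior R := by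
    have := hfv.symm.subset (by simp : q ∈ ({v, w, p, q} : Set Plane))
    exact ⟨⟨this.2, hR.isClosed.frontier_subset this.1⟩, this.1.2⟩
  have hdeg : ∀ d, d ≠ v → d ≠ w →
      ∀ S : Finset Plane, (S : Set Plane) ⊆ G.vertsIn R \ {v, w} →
        (∀ x ∈ S, G.graph.Adj d x) → S.card ≤ 2 := by
    intro d hdv hdw S hS hadj
    by_contra! hcon
    obtain ⟨a, b, c, ha, hb, hc, hab, hac, hbc⟩ := Finset.two_lt_card_iff.1 hcon
    exact hR.not_three_adj hdv hdw hab hbc hac (hS ha) (hS hb) (hS hc) (hadj _ ha) (hadj _ hb)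
      (hadj _ hc)
  have hfilterX : ∀ (d : Plane) (S : Finset Plane), S ⊆ I →
      ((S.filter (G.graph.Adj d) : Finset Plane) : Set Plane) ⊆ G.vertsIn R \ {v, w} :=
    fun d S hS x hx => memX x (hS (Finset.mem_filter.1 hx).1)
  have hadjI : ∀ x ∈ I, x ∉ J → (p ≠ v ∧ p ≠ w ∧ G.graph.Adj p x) ∨
      (q ≠ v ∧ q ≠ w ∧ G.graph.Adj q x) := by
    intro x hx hxJ
    rw [memI] at hx
    obtain ⟨u, hu, huv, huw, hxu⟩ := hR.exists_adj_frontier hx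
      fun h => hxJ ((memJ x).2 ⟨hx, h⟩)
    rcases hfv.subset hu.symm with h | h | h | h
    · exact absurd h huv
    · exact absurd h huw
    · obtain rfl : u = p := h
      exact Or.inl ⟨huv, huw, hxu.symm⟩
    · obtain rfl : u = q := h
      exact Or.inr ⟨huv, huw, hxu.symm⟩
  have hcardV : ∀ B : Finset Plane, (∀ x ∈ G.vertsIn R, x ∈ I ∨ x ∈ B) →
      12 ≤ I.card + B.card := by
    intro B hB
    have h1 : G.vertsIn R ⊆ ((I ∪ B : Finset Plane) : Set Plane) := by
      intro x hx
      simpa using hB x hx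
    have h2 := Set.ncard_le_ncard h1 (Finset.finite_toSet _)
    rw [Set.ncard_coe_finset] at h2
    exact h12.trans (h2.trans (Finset.card_union_le _ _))
  have hJcard : (G.verts ∩ interior R ∩ G.graph.nbhd₃ {v, w}).ncard = J.card :=
    Set.ncard_eq_toFinset_card _ hfinJ
  have hIJ : I.card ≤ (I \ J).card + J.card := by
    rw [Finset.card_sdiff_of_subset hJI]
    omega
  have hcases : 7 ≤ J.card ∨ (6 ≤ J.card ∧ (I.filter (G.graph.Adj p)).card ≤ 1 ∧
      (I.filter (G.graph.Adj q)).card ≤ 1) := by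
    by_cases hgen : p ≠ v ∧ p ≠ w ∧ q ≠ v ∧ q ≠ w ∧ p ≠ q
    · right
      obtain ⟨hpv, hpw, hqv, hqw, hpq⟩ := hgen
      obtain ⟨WP, π, ε₁, hP⟩ := hp.resolve_left hpv
      obtain ⟨WQ, κ, ε₂, hQ⟩ := hq.resolve_left hqv
      have one : ∀ u, (∀ a b, a ≠ b → a ∈ interior R → b ∈ interior R → G.graph.Adj v a →
          G.graph.Adj v b → G.graph.Adj w a → G.graph.Adj w b → G.graph.Adj u a →
          G.graph.Adj u b → False) → (I.filter (G.graph.Adj u)).card ≤ 1 := by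
        intro u hu
        by_contra! hcon
        obtain ⟨a, ha, b, hb, hab⟩ := Finset.one_lt_card.1 hcon
        rw [Finset.mem_filter, memI] at ha hb
        have h1 := hR.adj_of_mem_interior ha.1
        have h2 := hR.adj_of_mem_interior hb.1
        exact hu a b hab ha.1.2 hb.1.2 h1.1 h2.1 h1.2 h2.2 ha.2 hb.2
      have hp1 := one p fun a b hab ha hb =>
        not_adj_two_interior hR.isClosed hP hQ hf hpq hab ha hb
      have hq1 := one q fun a b hab ha hb =>
        not_adj_two_interior hR.isClosed hQ hP (hf.trans (union_comm _ _)) hpq.symm hab ha hb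
      refine ⟨?_, hp1, hq1⟩
      have h1 : I \ J ⊆ I.filter (G.graph.Adj p) ∪ I.filter (G.graph.Adj q) := by
        intro x hx
        rw [Finset.mem_sdiff] at hx
        rw [Finset.mem_union, Finset.mem_filter, Finset.mem_filter]
        rcases hadjI x hx.1 hx.2 with h | h
        · exact Or.inl ⟨hx.1, h.2.2⟩
        · exact Or.inr ⟨hx.1, h.2.2⟩
      have h2 := (Finset.card_le_card h1).trans (Finset.card_union_le _ _)
      have h3 := hcardV {v, w, p, q} fun x hx => (split x hx).imp_right (by simp)
      have h4 : ({v, w, p, q} : Finset Plane).card ≤ 4 := Finset.card_le_four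
      omega
    · left
      -- Degenerate boundary: u is the only possible boundary vertex besides v, w, and may itself be
      -- v or w, in which case all inner vertices are in N₃.
      have key : ∀ u ∈ G.vertsIn R, (∀ x ∈ ({v, w, p, q} : Set Plane), x ∈ ({v, w, u} : Set Plane)) →
          7 ≤ J.card := by
        intro u hu hsub
        have h3 := hcardV {v, w, u} fun x hx => (split x hx).imp_right
          fun h => by simpa using hsub x h
        have h4 : ({v, w, u} : Finset Plane).card ≤ 3 := Finset.card_le_three
        have h5 : (I \ J).card ≤ 2 := by
          by_cases huu : u ≠ v ∧ u ≠ w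
          · refine hdeg u huu.1 huu.2 (I \ J) (fun x hx => memX x (Finset.mem_sdiff.1 hx).1) ?_
            intro x hx
            rw [Finset.mem_sdiff] at hx
            rcases hadjI x hx.1 hx.2 with ⟨h1, h2, h⟩ | ⟨h1, h2, h⟩
            · rcases hsub p (by simp) with h' | h' | h'
              · exact absurd h' h1
              · exact absurd h' h2
              · rwa [← show p = u from h']
            · rcases hsub q (by simp) with h' | h' | h'
              · exact absurd h' h1
              · exact absurd h' h2
              · rwa [← show q = u from h']
          · have : I \ J = ∅ := by
              rw [Finset.eq_empty_iff_forall_notMem]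
              intro x hx
              rw [Finset.mem_sdiff] at hx
              apply huu
              rcases hadjI x hx.1 hx.2 with ⟨h1, h2, h⟩ | ⟨h1, h2, h⟩
              · rcases hsub p (by simp) with h' | h' | h'
                · exact absurd h' h1
                · exact absurd h' h2
                · rw [← show p = u from h']; exact ⟨h1, h2⟩
              · rcases hsub q (by simp) with h' | h' | h'
                · exact absurd h' h1
                · exact absurd h' h2
                · rw [← show q = u from h']; exact ⟨h1, h2⟩
            rw [this]; simp
        omega
      by_cases h1 : p = v ∨ p = w
      · refine key q qmem.1 fun x hx => ?_
        simp only [mem_insert_iff, mem_singleton_iff] at hx ⊢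
        rcases hx with h | h | h | h
        · exact Or.inl h
        · exact Or.inr (Or.inl h)
        · rw [h]; exact h1.imp_right Or.inl
        · exact Or.inr (Or.inr h)
      · refine key p pmem.1 fun x hx => ?_
        have h2 : q = v ∨ q = w ∨ q = p := by
          by_contra! hcon
          exact hgen ⟨fun h => h1 (Or.inl h), fun h => h1 (Or.inr h), hcon.1, hcon.2.1,
            hcon.2.2.symm⟩
        simp only [mem_insert_iff, mem_singleton_iff] at hx ⊢
        rcases hx with h | h | h | h
        · exact Or.inl h
        · exact Or.inr (Or.inl h)
        · exact Or.inr (Or.inr h)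
        · rw [h]; exact h2
  have hJ6 : 6 ≤ J.card := by
    rcases hcases with h | h
    · omega
    · exact h.1
  refine ⟨hJcard ▸ hJ6, ?_⟩
  rintro ⟨D, hD3, hDsub, -, hDdom, hDtot⟩
  -- Totality: a vertex of N₃ belonging to D also has a neighbour in D.
  have hdom : ∀ s ∈ J, ∃ d ∈ D, G.graph.Adj s d := by
    intro s hs
    have hs3 := ((memJ s).1 hs).2
    rcases hDdom s hs3 with h | h
    · exact hDtot s ⟨hs3, h⟩
    · exact h
  have hDne : ∀ d ∈ D, d ≠ v ∧ d ≠ w := by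
    intro d hd
    have : d ∈ G.graph.nbhd {v, w} := (hDsub hd).elim (fun h => h.1.1) fun h => h.1
    have := this.1
    simpa using this
  have hDR : ∀ d, ∀ s ∈ J, G.graph.Adj d s → d ∈ G.vertsIn R := by
    intro d s hs hds
    have hsI := ((memJ s).1 hs).1
    exact ⟨adj_left_mem hds, hR.mem_of_adj_interior hsI.2 hds.symm⟩
  have hDdeg : ∀ d ∈ D, (J.filter (G.graph.Adj d)).card ≤ 2 := by
    intro d hd
    rcases (J.filter (G.graph.Adj d)).eq_empty_or_nonempty with h | ⟨s, hs⟩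
    · simp [h]
    · rw [Finset.mem_filter] at hs
      exact hdeg d (hDne d hd).1 (hDne d hd).2 _ (hfilterX d J hJI)
        fun x hx => (Finset.mem_filter.1 hx).2
  obtain ⟨h6, htwo, hnsub⟩ := G.graph.not_subset_of_dominates_six J D hdom hDdeg hD3 hJ6
  obtain ⟨-, hp1, hq1⟩ := hcases.resolve_left (by omega)
  apply hnsub
  intro d hd
  have h2 := htwo d hd
  obtain ⟨s, hs⟩ := Finset.card_pos.1 (by rw [h2]; norm_num : 0 < (J.filter (G.graph.Adj d)).card)
  rw [Finset.mem_filter] at hs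
  have hdR := hDR d s hs.1 hs.2
  have hmono := Finset.card_le_card (Finset.filter_subset_filter (G.graph.Adj d) hJI)
  -- An element of D has two neighbours in J, whereas p and q have at most one inside R.
  have hdI : d ∈ I := by
    rcases split d hdR with h | h | h | h | h
    · exact h
    · exact absurd h (hDne d hd).1
    · exact absurd h (hDne d hd).2
    · obtain rfl : d = p := h
      omega
    · obtain rfl : d = q := h
      omega
  by_contra hdJ
  -- If d were inside but not in N₃, its boundary neighbour u would be a third neighbour besides the
  -- two in J.
  have key : ∀ u ∈ G.vertsIn R, u ∉ interior R → u ≠ v → u ≠ w → G.graph.Adj u d → False := by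
    intro u hu hui huv huw hud
    have huJ : u ∉ J.filter (G.graph.Adj d) := fun h =>
      hui ((memJ u).1 (Finset.mem_filter.1 h).1).1.2
    have hc := hdeg d (hDne d hd).1 (hDne d hd).2 (insert u (J.filter (G.graph.Adj d))) ?_ ?_
    · rw [Finset.card_insert_of_notMem huJ] at hc
      omega
    · rw [Finset.coe_insert, insert_subset_iff]
      exact ⟨⟨hu, by simp [huv, huw]⟩, hfilterX d J hJI⟩
    · intro x hx
      rcases Finset.mem_insert.1 hx with rfl | h
      · exact hud.symm
      · exact (Finset.mem_filter.1 h).2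
  rcases hadjI d hdI hdJ with ⟨h1, h2, h⟩ | ⟨h1, h2, h⟩
  · exact key p pmem.1 pmem.2 h1 h2 h
  · exact key q qmem.1 qmem.2 h1 h2 h

end PlaneGraph

/-! ## Subgraphs and shrinking -/

namespace PlaneGraph

variable {G H K : PlaneGraph} {v w : Plane} {R : Set Plane}

theorem eq_of_verts_edges (hv : G.verts = H.verts) (he : G.edges = H.edges) : G = H := by
  cases G; cases H; simp_all

theorem Iso.ncard_eq (h : G.Iso H) : G.verts.ncard = H.verts.ncard := by
  obtain ⟨f⟩ := h
  exact Nat.card_congr f.toEquiv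

theorem isArc_of_edge {x y : Plane} {e : Set Plane} (he : e ∈ G.edges) (hev : e ∩ G.verts = {x, y}) :
    IsArc x y e := by
  obtain ⟨x', -, y', -, ha, hv⟩ := G.isArc_edges e he
  have hne := ha.ne
  rw [hev] at hv
  have h1 : x = x' ∨ x = y' := by simpa using hv.subset (by simp : x ∈ ({x, y} : Set Plane))
  have h2 : y = x' ∨ y = y' := by simpa using hv.subset (by simp : y ∈ ({x, y} : Set Plane))
  have h3 : x' = x ∨ x' = y := by simpa using hv.symm.subset (by simp : x' ∈ ({x', y'} : Set Plane))
  have h4 : y' = x ∨ y' = y := by simpa using hv.symm.subset (by simp : y' ∈ ({x', y'} : Set Plane))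
  rcases h1 with rfl | rfl
  · rcases h4 with rfl | rfl
    · exact absurd rfl hne
    · exact ha
  · rcases h3 with rfl | rfl
    · exact absurd rfl hne
    · exact ha.symm

/-- `K` is an induced subgraph of `G`, with the same drawing. -/
structure IsInduced (K G : PlaneGraph) : Prop where
  verts_subset : K.verts ⊆ G.verts
  edges_eq : K.edges = {e ∈ G.edges | e ∩ G.verts ⊆ K.verts}

theorem isInduced_refl (G : PlaneGraph) : G.IsInduced G :=
  ⟨subset_rfl, by ext e; simp⟩

theorem isInduced_delete (G : PlaneGraph) (X : Set Plane) : (G.delete X).IsInduced G := by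
  refine ⟨sdiff_subset, ?_⟩
  ext e
  refine and_congr_right fun _ => ?_
  rw [disjoint_left]
  exact ⟨fun h z hz => ⟨hz.2, h hz⟩, fun h z hz => (h hz).2⟩

theorem IsInduced.trans (h : K.IsInduced H) (h' : H.IsInduced G) : K.IsInduced G := by
  refine ⟨h.verts_subset.trans h'.verts_subset, ?_⟩
  rw [h.edges_eq, h'.edges_eq]
  ext e
  constructor
  · rintro ⟨⟨h1, h2⟩, h3⟩
    exact ⟨h1, fun z hz => h3 ⟨hz.1, h2 hz⟩⟩
  · rintro ⟨h1, h2⟩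
    exact ⟨⟨h1, h2.trans h.verts_subset⟩, fun z hz => h2 ⟨hz.1, h'.verts_subset hz.2⟩⟩

theorem isInduced_of_reflTransGen {𝓡 : Set (Set Plane)}
    (h : Relation.ReflTransGen (ShrinkStep 𝓡) G H) :
    H.IsInduced G ∧ ∀ x ∈ G.verts, x ∉ H.verts → ∃ R ∈ 𝓡, x ∈ interior R := by
  induction h with
  | refl => exact ⟨isInduced_refl G, fun x h h' => absurd h h'⟩
  | tail _ hstep ih =>
    obtain ⟨R, hR, -, y, hy, hyR, rfl⟩ := hstep
    refine ⟨(isInduced_delete _ _).trans ih.1, fun x hx hx' => ?_⟩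
    by_cases hxy : x = y
    · exact ⟨R, hR, hxy ▸ hyR⟩
    · exact ih.2 x hx fun h => hx' ⟨h, hxy⟩

/-- The loop never gets stuck: a region with more than seven vertices has at most four on its
boundary, hence one strictly inside. It ends because vertices disappear. -/
theorem exists_shrink {𝓡 : Set (Set Plane)} :
    ∀ (n : ℕ) (H : PlaneGraph), H.verts.ncard = n →
      (∀ R ∈ 𝓡, IsClosed R ∧ (frontier R ∩ H.verts).ncard ≤ 4) → ∃ K, Shrink 𝓡 H K := by
  intro n
  induction n using Nat.strong_induction_on with
  | _ n ih =>
    intro H hn hfr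
    by_cases hall : ∀ R ∈ 𝓡, (H.vertsIn R).ncard ≤ 7
    · exact ⟨H, Relation.ReflTransGen.refl, hall⟩
    · push Not at hall
      obtain ⟨R, hR, h7⟩ := hall
      obtain ⟨x, hx, hxR⟩ : ∃ x ∈ H.verts, x ∈ interior R := by
        by_contra! hcon
        have : H.vertsIn R ⊆ frontier R ∩ H.verts :=
          fun x hx => ⟨⟨subset_closure hx.2, hcon x hx.1⟩, hx.1⟩
        have h1 := Set.ncard_le_ncard this (H.finite_verts.subset inter_subset_right)
        have h2 := (hfr R hR).2
        omega
      have hlt : (H.delete {x}).verts.ncard < n :=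
        hn ▸ Set.ncard_sdiff_singleton_lt_of_mem hx H.finite_verts
      obtain ⟨K, hK, hK7⟩ := ih _ hlt (H.delete {x}) rfl fun S hS => ⟨(hfr S hS).1,
        (Set.ncard_le_ncard (inter_subset_inter_right _ sdiff_subset)
          (H.finite_verts.subset inter_subset_right)).trans (hfr S hS).2⟩
      exact ⟨K, hK.head ⟨R, hR, h7, x, hx, hxR, rfl⟩, hK7⟩

theorem IsSimpleRegion.ncard_frontier_le (hR : G.IsSimpleRegion v w R) :
    (frontier R ∩ G.verts).ncard ≤ 4 := by
  classical
  obtain ⟨p, q, h⟩ := hR.exists_frontier_inter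
  rw [h]
  have : ({v, w, p, q} : Set Plane) = (({v, w, p, q} : Finset Plane) : Set Plane) := by simp
  rw [this, Set.ncard_coe_finset]
  exact Finset.card_le_four

theorem exists_shrink_maximalRegions (G : PlaneGraph) (w : Plane) (U : Set Plane) :
    ∃ H, Shrink (G.maximalRegions w U) G H := by
  refine exists_shrink _ G rfl ?_
  rintro R ⟨u, -, hR, -⟩
  exact ⟨hR.isClosed, hR.ncard_frontier_le⟩

theorem Shrink.isInduced {𝓡 : Set (Set Plane)} (h : Shrink 𝓡 G H) : H.IsInduced G :=
  (isInduced_of_reflTransGen h.1).1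

theorem Shrink.ncard_add_five_le {𝓡 : Set (Set Plane)} (h : Shrink 𝓡 G H) (hR : R ∈ 𝓡)
    (h12 : 12 ≤ (G.vertsIn R).ncard) : H.verts.ncard + 5 ≤ G.verts.ncard := by
  have h7 := h.2 R hR
  have hsub := h.isInduced.verts_subset
  have h1 : (H.vertsIn R) ⊆ G.vertsIn R := inter_subset_inter_left _ hsub
  have h2 := Set.ncard_sdiff_add_ncard_of_subset h1 (G.finite_vertsIn R)
  have hd : Disjoint H.verts (G.vertsIn R \ H.vertsIn R) := by
    rw [disjoint_left]
    rintro x hx ⟨hx1, hx2⟩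
    exact hx2 ⟨hx, hx1.2⟩
  have h3 := Set.ncard_union_eq hd H.finite_verts ((G.finite_vertsIn R).subset sdiff_subset)
  have h4 : H.verts ∪ (G.vertsIn R \ H.vertsIn R) ⊆ G.verts :=
    union_subset hsub (sdiff_subset.trans inter_subset_left)
  have h5 := Set.ncard_le_ncard h4 G.finite_verts
  omega

theorem IsSimpleRegion.exists_maximal (hR : G.IsSimpleRegion v w R) :
    ∃ R', G.IsMaximalSimpleRegion v w R' ∧ G.vertsIn R ⊆ G.vertsIn R' := by
  have hfin : {S | ∃ R', G.IsSimpleRegion v w R' ∧ S = G.vertsIn R'}.Finite := by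
    refine G.finite_verts.finite_subsets.subset ?_
    rintro _ ⟨R', -, rfl⟩
    exact inter_subset_left
  obtain ⟨_, hle, ⟨R', hR', rfl⟩, hmax⟩ := hfin.exists_le_maximal ⟨R, hR, rfl⟩
  exact ⟨R', ⟨hR', fun S hS hle' => hmax ⟨S, hS, rfl⟩ hle'⟩, hle⟩

/-! ### Adding vertices within a given drawing -/

/-- `K` is a subgraph of `G`, with the same drawing. -/
structure IsSubgraph (K G : PlaneGraph) : Prop where
  verts_subset : K.verts ⊆ G.verts
  edges_subset : K.edges ⊆ G.edges

theorem IsInduced.isSubgraph (h : K.IsInduced G) : K.IsSubgraph G :=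
  ⟨h.verts_subset, h.edges_eq.subset.trans fun _ he => he.1⟩

theorem IsSubgraph.inter_verts (h : K.IsSubgraph G) {e : Set Plane} (he : e ∈ K.edges) :
    e ∩ G.verts = e ∩ K.verts := by
  obtain ⟨x, -, y, -, ha, hv⟩ := K.isArc_edges e he
  rw [hv, inter_verts_of_isArc (h.edges_subset he) ha]

/-- A vertex of `G` outside a subgraph `K` can be added to `K`, together with some of its edges. -/
theorem IsSubgraph.exists_addVertex (h : K.IsSubgraph G) {x : Plane} (hx : x ∈ G.verts)
    (hxK : x ∉ K.verts) {A : Set Plane} (hA : A ⊆ K.verts) (hadj : ∀ a ∈ A, G.graph.Adj x a) :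
    ∃ H : PlaneGraph, H.IsSubgraph G ∧ H.verts = insert x K.verts ∧ K.AddVertex A H := by
  have hVG : insert x K.verts ⊆ G.verts := insert_subset hx h.verts_subset
  -- Every edge of the new graph is an edge of G with both ends among the new vertices, so the plane
  -- graph axioms are inherited from G.
  have hcl : ∀ e ∈ K.edges ∪ {e ∈ G.edges | ∃ a ∈ A, e ∩ G.verts = {x, a}},
      e ∈ G.edges ∧ e ∩ G.verts = e ∩ insert x K.verts := by
    rintro e (he | ⟨he, a, ha, hea⟩)
    · refine ⟨h.edges_subset he, subset_antisymm ?_ (inter_subset_inter_right _ hVG)⟩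
      rw [h.inter_verts he]
      exact inter_subset_inter_right _ (subset_insert _ _)
    · refine ⟨he, subset_antisymm ?_ (inter_subset_inter_right _ hVG)⟩
      intro z hz
      refine ⟨hz.1, ?_⟩
      rcases hea.subset hz with h1 | h1
      · exact Or.inl h1
      · exact Or.inr (hA ((show z = a from h1) ▸ ha))
  let H : PlaneGraph :=
    { verts := insert x K.verts
      edges := K.edges ∪ {e ∈ G.edges | ∃ a ∈ A, e ∩ G.verts = {x, a}}
      finite_verts := K.finite_verts.insert x
      isArc_edges := by
        intro e he
        obtain ⟨he1, he2⟩ := hcl e he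
        obtain ⟨y, -, z, -, ha, hv⟩ := G.isArc_edges e he1
        rw [he2] at hv
        exact ⟨y, (hv.symm.subset (by simp : y ∈ ({y, z} : Set Plane))).2, z,
          (hv.symm.subset (by simp : z ∈ ({y, z} : Set Plane))).2, ha, hv⟩
      simple := by
        intro e he f hf hef
        obtain ⟨he1, he2⟩ := hcl e he
        obtain ⟨hf1, hf2⟩ := hcl f hf
        exact G.simple e he1 f hf1 (by rw [he2, hf2, hef])
      noncrossing := by
        intro e he f hf hne z hz
        obtain ⟨he1, he2⟩ := hcl e he
        have := he2.subset ⟨hz.1, G.noncrossing e he1 f (hcl f hf).1 hne hz⟩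
        exact this.2 }
  have hxe : ∀ e ∈ K.edges, x ∉ e := by
    intro e he hxe
    exact hxK ((h.inter_verts he).subset ⟨hxe, hx⟩).2
  refine ⟨H, ⟨hVG, fun e he => (hcl e he).1⟩, rfl, x, mem_insert _ _, ?_, ?_⟩
  · refine eq_of_verts_edges ?_ ?_
    · exact insert_sdiff_self_of_notMem hxK
    · ext e
      constructor
      · rintro ⟨he | ⟨he, a, ha, hea⟩, hd⟩
        · exact he
        · have hxe' := hea.symm.subset (by simp : x ∈ ({x, a} : Set Plane))
          exact absurd rfl (disjoint_left.1 hd ⟨hxe'.1, mem_insert _ _⟩)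
      · intro he
        refine ⟨Or.inl he, ?_⟩
        rw [disjoint_singleton_right]
        exact fun hh => hxe e he hh.1
  · ext y
    constructor
    · rintro ⟨e, he | ⟨he, a, ha, hea⟩, harc⟩
      · exact absurd harc.left_mem (hxe e he)
      · have := inter_verts_of_isArc he harc
        rw [hea] at this
        rcases this.symm.subset (by simp : y ∈ ({x, y} : Set Plane)) with h1 | h1
        · exact absurd h1.symm harc.ne
        · exact (show y = a from h1) ▸ ha
    · intro hy
      obtain ⟨e, he, harc, hev⟩ := exists_edge (hadj y hy)
      exact ⟨e, Or.inr ⟨he, y, hy, hev⟩, harc⟩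

end PlaneGraph

/-! ## Drawing a pendant edge -/

theorem affineSpan_pair_ne_top (a b : Plane) : affineSpan ℝ {a, b} ≠ ⊤ := by
  intro h
  have h1 := (collinear_iff_finrank_le_one (k := ℝ)).1 (collinear_pair ℝ a b)
  rw [← direction_affineSpan, h, AffineSubspace.direction_top, finrank_top] at h1
  simp at h1

theorem volume_line (a b : Plane) :
    MeasureTheory.volume (affineSpan ℝ {a, b} : Set Plane) = 0 :=
  MeasureTheory.Measure.addHaar_affineSubspace _ _ (affineSpan_pair_ne_top a b)

theorem segment_subset_line (a b : Plane) : segment ℝ a b ⊆ affineSpan ℝ {a, b} := by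
  rw [segment_eq_image_lineMap]
  rintro _ ⟨t, -, rfl⟩
  exact AffineMap.lineMap_mem_affineSpan_pair t a b

theorem IsArc.volume_eq_zero {x y : Plane} {e : Set Plane} (h : IsArc x y e) :
    MeasureTheory.volume e = 0 := by
  obtain ⟨n, p, -, -, -, -, -, rfl⟩ := h
  refine (MeasureTheory.measure_biUnion_null_iff (Set.finite_lt_nat n).countable).2 fun i _ => ?_
  exact MeasureTheory.measure_mono_null (segment_subset_line _ _) (volume_line _ _)

/-- For almost all points `z` near `v`, the segment `[v, z]` avoids `s` except for `v`. -/
def AlmostAvoids (v : Plane) (s : Set Plane) : Prop :=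
  ∀ᶠ z in nhds v ⊓ MeasureTheory.ae MeasureTheory.volume, segment ℝ v z ∩ s ⊆ {v}

theorem almostAvoids_segment (v a b : Plane) : AlmostAvoids v (segment ℝ a b) := by
  by_cases hv : v ∈ segment ℝ a b
  · have h0 : ∀ᵐ z : Plane, z ∉ (affineSpan ℝ {a, b} : Set Plane) :=
      MeasureTheory.measure_eq_zero_iff_ae_notMem.1 (volume_line a b)
    refine Filter.Eventually.filter_mono inf_le_right (h0.mono fun z hz => ?_)
    rintro u ⟨hu, hu'⟩
    -- A point u ≠ v of the line on the segment [v, z] would put z on the line through v and u,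
    -- which almost every z avoids.
    by_contra hne
    apply hz
    rw [segment_eq_image_lineMap] at hu
    obtain ⟨t, -, rfl⟩ := hu
    have ht : t ≠ 0 := by
      rintro rfl
      exact hne (by simp)
    have h1 := AffineMap.lineMap_mem (Q := affineSpan ℝ {a, b}) t⁻¹ (segment_subset_line a b hv)
      (segment_subset_line a b hu')
    have h2 : AffineMap.lineMap v (AffineMap.lineMap v z t) t⁻¹ = z := by
      simp only [AffineMap.lineMap_apply, vsub_eq_sub, vadd_eq_add, add_sub_cancel_right, smul_smul,
        inv_mul_cancel₀ ht, one_smul, sub_add_cancel]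
    rwa [h2] at h1
  · obtain ⟨ε, hε, hball⟩ := Metric.isOpen_iff.1 (isClosed_segment_plane a b).isOpen_compl v hv
    refine Filter.Eventually.filter_mono inf_le_left ?_
    filter_upwards [Metric.ball_mem_nhds v hε] with z hz
    rintro u ⟨hu, hu'⟩
    exact absurd hu' (hball ((convex_ball v ε).segment_subset (Metric.mem_ball_self hε) hz hu))

theorem almostAvoids_biUnion {ι : Type*} {I : Set ι} (hI : I.Finite) {v : Plane}
    {s : ι → Set Plane} (h : ∀ i ∈ I, AlmostAvoids v (s i)) : AlmostAvoids v (⋃ i ∈ I, s i) := by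
  refine ((Filter.eventually_all_finite hI).2 h).mono fun z hz => ?_
  rintro u ⟨hu, hu'⟩
  simp only [mem_iUnion, exists_prop] at hu'
  obtain ⟨i, hi, hui⟩ := hu'
  exact hz i hi ⟨hu, hui⟩

theorem IsArc.almostAvoids {x y : Plane} {e : Set Plane} (h : IsArc x y e) (v : Plane) :
    AlmostAvoids v e := by
  obtain ⟨n, p, -, -, -, -, -, rfl⟩ := h
  exact almostAvoids_biUnion (I := {i | i < n}) (Set.finite_lt_nat n)
    fun i _ => almostAvoids_segment v _ _

/-- Near v the open set has positive measure, so the null set of bad points cannot cover it. -/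
theorem AlmostAvoids.exists_mem {v : Plane} {s U : Set Plane} (h : AlmostAvoids v s)
    (hU : IsOpen U) (hv : v ∈ closure U) : ∃ z ∈ U, segment ℝ v z ∩ s ⊆ {v} := by
  obtain ⟨t₁, h1, t₂, h2, h3⟩ := Filter.mem_inf_iff.1 h
  have hne : (interior t₁ ∩ U).Nonempty :=
    mem_closure_iff.1 hv _ isOpen_interior (mem_interior_iff_mem_nhds.2 h1)
  have hpos := (isOpen_interior.inter hU).measure_pos MeasureTheory.volume hne
  have : (interior t₁ ∩ U ∩ t₂).Nonempty := by
    by_contra hcon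
    have hsub : interior t₁ ∩ U ⊆ t₂ᶜ := fun z hz hz2 => hcon ⟨z, hz, hz2⟩
    exact hpos.ne' (MeasureTheory.measure_mono_null hsub (MeasureTheory.mem_ae_iff.1 h2))
  obtain ⟨z, ⟨hz1, hzU⟩, hz2⟩ := this
  have hmem : z ∈ t₁ ∩ t₂ := ⟨interior_subset hz1, hz2⟩
  rw [← h3] at hmem
  exact ⟨z, hzU, hmem⟩

namespace PlaneGraph

variable {G K : PlaneGraph} {v w : Plane} {R : Set Plane}

theorem finite_edges (G : PlaneGraph) : G.edges.Finite := by
  refine Set.Finite.of_injOn (f := fun e => e ∩ G.verts) (t := {s | s ⊆ G.verts}) ?_ ?_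
    G.finite_verts.finite_subsets
  · exact fun e _ => inter_subset_right
  · exact fun e he f hf h => G.simple e he f hf h

/-- A new pendant edge can be drawn at a vertex `v` on the boundary of `R`, ending outside `R`. -/
theorem exists_pendant (hv : v ∈ G.verts) (hR : IsClosed R) (hvR : v ∈ frontier R) :
    ∃ (H : PlaneGraph) (z : Plane), z ∉ G.verts ∧ z ∉ R ∧ (∀ e ∈ G.edges, z ∉ e) ∧
      H.verts = insert z G.verts ∧ H.edges = insert (segment ℝ v z) G.edges ∧
      G.AddVertex {v} H := by
  -- The vertices are listed separately because isolated ones lie on no edge.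
  have havoid : AlmostAvoids v ((⋃ e ∈ G.edges, e) ∪ ⋃ x ∈ G.verts, {x}) := by
    rw [← Set.sUnion_eq_biUnion, union_eq_iUnion, ← biUnion_univ]
    refine almostAvoids_biUnion Set.finite_univ ?_
    rintro (_ | _) -
    · refine almostAvoids_biUnion G.finite_verts fun x _ => ?_
      simpa using almostAvoids_segment v x x
    · rw [cond_true, Set.sUnion_eq_biUnion]
      refine almostAvoids_biUnion G.finite_edges fun e he => ?_
      obtain ⟨x, -, y, -, ha, -⟩ := G.isArc_edges e he
      exact ha.almostAvoids v
  have hvc : v ∈ closure Rᶜ := by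
    rw [frontier_eq_closure_inter_closure] at hvR
    exact hvR.2
  obtain ⟨z, hzR, hz⟩ := havoid.exists_mem hR.isOpen_compl hvc
  have hvz : v ≠ z := by
    rintro rfl
    exact hzR (hR.frontier_subset hvR)
  set s := segment ℝ v z with hs
  have hse : ∀ e ∈ G.edges, s ∩ e ⊆ {v} := fun e he =>
    (inter_subset_inter_right _ ((subset_biUnion_of_mem (u := fun e => e) he).trans
      subset_union_left)).trans hz
  have hsv : s ∩ G.verts ⊆ {v} := fun x hx => hz ⟨hx.1, Or.inr (by simpa using hx.2)⟩
  have hzs : z ∈ s := right_mem_segment ℝ v z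
  have hvs : v ∈ s := left_mem_segment ℝ v z
  have hze : ∀ e ∈ G.edges, z ∉ e := fun e he h => hvz (hse e he ⟨hzs, h⟩).symm
  have hzv : z ∉ G.verts := fun h => hvz (hsv ⟨hzs, h⟩).symm
  have hev : ∀ e ∈ G.edges, e ∩ insert z G.verts = e ∩ G.verts := by
    intro e he
    refine subset_antisymm ?_ (inter_subset_inter_right _ (subset_insert _ _))
    rintro x ⟨hx, rfl | hx'⟩
    · exact absurd hx (hze e he)
    · exact ⟨hx, hx'⟩
  have hsv' : s ∩ insert z G.verts = {v, z} := by
    ext x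
    constructor
    · rintro ⟨hx, rfl | hx'⟩
      · exact Or.inr rfl
      · exact Or.inl (hsv ⟨hx, hx'⟩)
    · rintro (rfl | rfl)
      · exact ⟨hvs, Or.inr hv⟩
      · exact ⟨hzs, Or.inl rfl⟩
  have hne : ∀ e ∈ G.edges, s ∩ insert z G.verts ≠ e ∩ insert z G.verts := by
    intro e he h
    exact hze e he (h.subset ⟨hzs, mem_insert _ _⟩).1
  let H : PlaneGraph :=
    { verts := insert z G.verts
      edges := insert s G.edges
      finite_verts := G.finite_verts.insert z
      isArc_edges := by
        rintro e (rfl | he)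
        · exact ⟨v, Or.inr hv, z, Or.inl rfl, isArc_segment hvz, hsv'⟩
        · obtain ⟨x, hx, y, hy, ha, hxy⟩ := G.isArc_edges e he
          exact ⟨x, Or.inr hx, y, Or.inr hy, ha, (hev e he).trans hxy⟩
      simple := by
        rintro e (rfl | he) f (rfl | hf) h
        · rfl
        · exact absurd h (hne f hf)
        · exact absurd h.symm (hne e he)
        · rw [hev e he, hev f hf] at h
          exact G.simple e he f hf h
      noncrossing := by
        rintro e (rfl | he) f (rfl | hf) hef x hx
        · exact absurd rfl hef
        · rw [show x = v from hse f hf hx]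
          exact Or.inr hv
        · rw [show x = v from hse e he hx.symm]
          exact Or.inr hv
        · exact Or.inr (G.noncrossing e he f hf hef hx) }
  refine ⟨H, z, hzv, hzR, hze, rfl, rfl, z, mem_insert _ _, ?_, ?_⟩
  · refine eq_of_verts_edges (insert_sdiff_self_of_notMem hzv) ?_
    ext e
    constructor
    · rintro ⟨rfl | he, hd⟩
      · exact absurd rfl (disjoint_left.1 hd ⟨hzs, mem_insert _ _⟩)
      · exact he
    · intro he
      refine ⟨Or.inr he, ?_⟩
      rw [disjoint_singleton_right]
      exact fun h => hze e he h.1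
  · ext y
    constructor
    · rintro ⟨e, rfl | he, ha⟩
      · have h1 := inter_verts_of_isArc (G := H) (mem_insert _ _) ha
        have h2 : y ∈ ({v, z} : Set Plane) := by
          rw [← hsv', show s ∩ insert z G.verts = {z, y} from h1]
          simp
        rcases h2 with h | h
        · exact h
        · exact absurd (show y = z from h).symm ha.ne
      · exact absurd ha.left_mem (hze e he)
    · intro hy
      rw [mem_singleton_iff] at hy
      subst hy
      exact ⟨s, mem_insert _ _, (isArc_segment hvz).symm⟩

/-! ## Transferring simple regions -/

theorem isClosed_drawing (P : G.graph.Walk v w) : IsClosed (G.drawing P) := by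
  induction P with
  | nil => rw [drawing_nil]; exact isClosed_empty
  | cons h P ih =>
    obtain ⟨e, he, hea, hev⟩ := exists_edge h
    rw [drawing_cons h P he hev]
    exact hea.isClosed.union ih

theorem volume_drawing (P : G.graph.Walk v w) : MeasureTheory.volume (G.drawing P) = 0 := by
  induction P with
  | nil => rw [drawing_nil]; exact MeasureTheory.measure_empty
  | cons h P ih =>
    obtain ⟨e, he, hea, hev⟩ := exists_edge h
    rw [drawing_cons h P he hev]
    exact MeasureTheory.measure_union_null hea.volume_eq_zero ih

/-- A path of length at most two is a simple region. -/
theorem isSimpleRegion_drawing (hvw : v ≠ w) (P : G.graph.Walk v w) (hP : P.IsPath)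
    (hl : P.length ≤ 2) : G.IsSimpleRegion v w (G.drawing P) := by
  have hc := isClosed_drawing P
  refine ⟨hvw, hc, ⟨P, P, hP, hP, hl, hl, ?_⟩, ?_⟩
  -- A null set has empty interior, so the drawing is its own frontier, with P serving as both
  -- boundary paths.
  · rw [hc.frontier_eq, MeasureTheory.Measure.interior_eq_empty_of_null (volume_drawing P)]
    simp
  · obtain ⟨p, hp, hp', -⟩ := exists_drawing_eq hvw P hP hl
    rintro x ⟨⟨hxv, hxP⟩, hx⟩
    simp only [mem_insert_iff, mem_singleton_iff, not_or] at hx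
    rcases hp.subset ⟨hxP, hxv⟩ with h | h | h
    · exact absurd h hx.1
    · exact absurd h hx.2
    · obtain rfl : x = p := h
      obtain ⟨W, π, ε, hA⟩ := hp'.resolve_left hx.1
      obtain ⟨e, he, f, hf, -, h1, h2⟩ := hA.edges
      exact ⟨⟨e, he, isArc_of_edge he h1⟩, ⟨f, hf, (isArc_of_edge hf h2).symm⟩⟩

theorem support_subset_drawing (P : G.graph.Walk v w) (hl : 0 < P.length) :
    ∀ x ∈ P.support, x ∈ G.drawing P ∩ G.verts := by
  induction P with
  | nil => simp at hl
  | cons h P ih =>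
    obtain ⟨e, he, hea, hev⟩ := exists_edge h
    rw [drawing_cons h P he hev]
    intro x hx
    rw [SimpleGraph.Walk.support_cons, List.mem_cons] at hx
    rcases hx with rfl | hx
    · exact ⟨Or.inl hea.left_mem, adj_left_mem h⟩
    · cases P with
      | nil =>
        rw [SimpleGraph.Walk.support_nil, List.mem_singleton] at hx
        subst hx
        exact ⟨Or.inl hea.right_mem, adj_right_mem h⟩
      | cons h' P' =>
        have := ih (by simp) x hx
        exact ⟨Or.inr this.1, this.2⟩

/-- A walk is transferred to a graph containing its vertices and edges, with the same drawing. -/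
theorem exists_walk_transfer (hK : ∀ e ∈ G.edges, ∀ x ∈ K.verts, ∀ y ∈ K.verts,
    e ∩ G.verts = {x, y} → e ∈ K.edges ∧ e ∩ K.verts = {x, y}) (P : G.graph.Walk v w)
    (hP : ∀ x ∈ P.support, x ∈ K.verts) :
    ∃ P' : K.graph.Walk v w, P'.support = P.support ∧ K.drawing P' = G.drawing P := by
  induction P with
  | nil => exact ⟨.nil, rfl, by rw [drawing_nil, drawing_nil]⟩
  | @cons v u w h P ih =>
    obtain ⟨P', hs, hd⟩ := ih fun x hx => hP x (by simp [hx])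
    obtain ⟨e, he, hea, hev⟩ := exists_edge h
    obtain ⟨heK, hevK⟩ := hK e he v (hP v (by simp)) u (hP u (by simp)) hev
    have hadj : K.graph.Adj v u := ⟨e, heK, hea⟩
    exact ⟨.cons hadj P', by simp [hs], by
      rw [drawing_cons hadj P' heK hevK, drawing_cons h P he hev, hd]⟩

end PlaneGraph

/-! ## Applying Rule 2 to a pair of vertices with a large region -/

namespace PlaneGraph

variable {G H K : PlaneGraph} {v w : Plane} {R : Set Plane}

/-- The point set R is kept. Boundary paths and adjacencies involve only vertices in R, so they
survive when K has the same vertices in R and contains all edges of G between its own vertices. -/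
theorem IsSimpleRegion.transfer (hR : G.IsSimpleRegion v w R)
    (hK : ∀ e ∈ G.edges, ∀ x ∈ K.verts, ∀ y ∈ K.verts,
      e ∩ G.verts = {x, y} → e ∈ K.edges ∧ e ∩ K.verts = {x, y})
    (hV : K.vertsIn R = G.vertsIn R) : K.IsSimpleRegion v w R := by
  have hVK : ∀ x ∈ G.vertsIn R, x ∈ K.verts := fun x hx => (hV.symm.subset hx).1
  have hadj : ∀ x ∈ G.vertsIn R, ∀ y ∈ G.vertsIn R, G.graph.Adj x y → K.graph.Adj x y := by
    intro x hx y hy hxy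
    obtain ⟨e, he, hea, hev⟩ := exists_edge hxy
    exact ⟨e, (hK e he x (hVK x hx) y (hVK y hy) hev).1, hea⟩
  have hv := hR.left_mem
  have hw := hR.right_mem
  obtain ⟨hvw, hc, ⟨P, Q, hP, hQ, hPl, hQl, hf⟩, hnb⟩ := hR
  have htr : ∀ P : G.graph.Walk v w, P.IsPath → P.length ≤ 2 → G.drawing P ⊆ frontier R →
      ∃ P' : K.graph.Walk v w, P'.IsPath ∧ P'.length ≤ 2 ∧ K.drawing P' = G.drawing P := by
    intro P hP hPl hPf
    have hpos : 0 < P.length := by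
      rcases Nat.eq_zero_or_pos P.length with h | h
      · exact absurd (SimpleGraph.Walk.eq_of_length_eq_zero h) hvw
      · exact h
    obtain ⟨P', hs, hd⟩ := exists_walk_transfer hK P fun x hx =>
      have h := support_subset_drawing P hpos x hx
      hVK x ⟨h.2, hc.frontier_subset (hPf h.1)⟩
    refine ⟨P', ?_, ?_, hd⟩
    · rw [SimpleGraph.Walk.isPath_def, hs]
      exact (SimpleGraph.Walk.isPath_def P).1 hP
    · have h1 := P'.length_support
      rw [hs, P.length_support] at h1
      omega
  obtain ⟨P', hP', hPl', hPd⟩ := htr P hP hPl (hf ▸ subset_union_left)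
  obtain ⟨Q', hQ', hQl', hQd⟩ := htr Q hQ hQl (hf ▸ subset_union_right)
  refine ⟨hvw, hc, ⟨P', Q', hP', hQ', hPl', hQl', by rw [hPd, hQd, hf]⟩, ?_⟩
  rw [hV]
  intro x hx
  exact ⟨hadj v hv x hx.1 (hnb hx).1, hadj w hw x hx.1 (hnb hx).2⟩

/-- Three deleted vertices a, b, c, each adjacent to both v and w, are put back with fewer edges as
v', w' and y; no new drawing is needed. At least six vertices go and three return. -/
theorem exists_rule2Case1 (hR : G.IsSimpleRegion v w R)
    (h6 : 6 ≤ (G.verts ∩ interior R ∩ G.graph.nbhd₃ {v, w}).ncard)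
    (hv : G.graph.domSets v w = ∅) (hw : G.graph.domSets w v = ∅) :
    ∃ G', G.Rule2Case1 v w G' ∧ G'.verts.ncard < G.verts.ncard := by
  set J := G.verts ∩ interior R ∩ G.graph.nbhd₃ {v, w} with hJ
  have hJfin : J.Finite := G.finite_verts.subset (inter_subset_left.trans inter_subset_left)
  obtain ⟨a, b, c, ha, hb, hc, hab, hac, hbc⟩ := (Set.two_lt_ncard_iff hJfin).1
    (by omega : 2 < J.ncard)
  have hadj : ∀ x ∈ J, G.graph.Adj v x ∧ G.graph.Adj w x := fun x hx => hR.adj_of_mem_interior hx.1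
  set N := G.graph.nbhd₃ {v, w} with hN
  have hvN : v ∉ N := fun h => h.1.1 (by simp)
  have hwN : w ∉ N := fun h => h.1.1 (by simp)
  have hvK : v ∈ (G.delete N).verts := ⟨hR.left_mem.1, hvN⟩
  have hwK : w ∈ (G.delete N).verts := ⟨hR.right_mem.1, hwN⟩
  have hJK : ∀ x ∈ J, x ∉ (G.delete N).verts := fun x hx h => h.2 hx.2
  obtain ⟨H₁, hs₁, hv₁, hadd₁⟩ := (isInduced_delete G N).isSubgraph.exists_addVertex ha.1.1
    (hJK a ha) (A := {v}) (by simpa using hvK) (by simpa using (hadj a ha).1.symm)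
  obtain ⟨H₂, hs₂, hv₂, hadd₂⟩ := hs₁.exists_addVertex hb.1.1
    (by rw [hv₁]; simpa [hab.symm] using hJK b hb)
    (A := {w}) (by rw [hv₁]; simpa using Or.inr hwK) (by simpa using (hadj b hb).2.symm)
  obtain ⟨H₃, hs₃, hv₃, hadd₃⟩ := hs₂.exists_addVertex hc.1.1
    (by rw [hv₂, hv₁]; simpa [hac.symm, hbc.symm] using hJK c hc)
    (A := {v, w}) (by
      rw [hv₂, hv₁]
      rintro x (rfl | rfl)
      · exact Or.inr (Or.inr hvK)
      · exact Or.inr (Or.inr hwK))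
    (by
      rintro x (rfl | rfl)
      · exact (hadj c hc).1.symm
      · exact (hadj c hc).2.symm)
  refine ⟨H₃, ⟨hv, hw, H₁, H₂, hadd₁, hadd₂, Or.inl ⟨⟨c, hc.2, hadj c hc⟩, hadd₃⟩⟩, ?_⟩
  have h1 := Set.ncard_insert_le a (G.delete N).verts
  have h2 := Set.ncard_insert_le b H₁.verts
  have h3 := Set.ncard_insert_le c H₂.verts
  rw [← hv₁] at h1
  rw [← hv₂] at h2
  rw [← hv₃] at h3
  have hd : Disjoint (G.delete N).verts J := by
    rw [disjoint_right]
    exact hJK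
  have h4 := Set.ncard_union_eq hd (G.delete N).finite_verts hJfin
  have hsub : (G.delete N).verts ∪ J ⊆ G.verts :=
    union_subset (isInduced_delete G N).verts_subset (inter_subset_left.trans inter_subset_left)
  have h5 := Set.ncard_le_ncard hsub G.finite_verts
  omega

/-- Since v belongs to D, a maximal region between w and v containing the vertices of R is in the
first family. The second shrinking can only lose further vertices. -/
theorem exists_rule2Case2 (hR : G.IsSimpleRegion v w R) (h12 : 12 ≤ (G.vertsIn R).ncard)
    (hv : (G.graph.domSets v w).Nonempty) (hw : (G.graph.domSets w v).Nonempty) :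
    ∃ G', G.Rule2Case2 v w G' ∧ G'.verts.ncard < G.verts.ncard := by
  obtain ⟨D, hD⟩ := hv
  obtain ⟨D', hD'⟩ := hw
  obtain ⟨H, hH⟩ := G.exists_shrink_maximalRegions w (D : Set Plane)
  obtain ⟨G', hG'⟩ := H.exists_shrink_maximalRegions v (D' : Set Plane)
  refine ⟨G', ⟨D, hD, D', hD', H, hH, hG'⟩, ?_⟩
  obtain ⟨S, hS, hRS⟩ := hR.symm.exists_maximal
  have h1 := hH.ncard_add_five_le (R := S) ⟨v, hD.2.1, hS⟩
    (h12.trans (Set.ncard_le_ncard hRS (G.finite_vertsIn S)))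
  have h2 := Set.ncard_le_ncard hG'.isInduced.verts_subset H.finite_verts
  omega

/-- If some neighbour of `w` lies in `N₃(v,w)` and `𝒟_v` is nonempty, then `𝒟_v` has a member
with an element other than `v` at distance one or two from `w`. -/
theorem exists_domSets_path (hvw : v ≠ w) {x : Plane} (hx : x ∈ G.graph.nbhd₃ {v, w})
    (hxw : G.graph.Adj w x) (hv : (G.graph.domSets v w).Nonempty) :
    ∃ D ∈ G.graph.domSets v w, ∃ d ∈ D, d ≠ v ∧ d ≠ w ∧
      (G.graph.Adj w d ∨ ∃ c, G.graph.Adj w c ∧ G.graph.Adj c d) := by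
  classical
  obtain ⟨D, hD⟩ := hv
  have hne : ∀ d ∈ D, d ≠ v → d ≠ w := by
    rintro d hd hdv rfl
    rcases hD.2.2.1 hd with (h | h) | h
    · exact h.1.1.1 (by simp)
    · exact h.1.1 (by simp)
    · exact hdv h
  -- If this fails, no element of D other than v dominates a neighbour of w. A vertex of N₃(v,w)
  -- dominated by such an element is thus a neighbour of v, so v alone dominates N₃(v,w) and {v, x}
  -- may replace D.
  by_cases h : ∃ d ∈ D, d ≠ v ∧ ∃ c, G.graph.Adj w c ∧ G.graph.Adj c d
  · obtain ⟨d, hd, hdv, c, hc⟩ := h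
    exact ⟨D, hD, d, hd, hdv, hne d hd hdv, Or.inr ⟨c, hc⟩⟩
  · have hxv : x ≠ v := fun h => hx.1.1 (by simp [h])
    have hxw' : x ≠ w := hxw.ne'
    refine ⟨{v, x}, ⟨?_, by simp, ?_, ?_⟩, x, by simp, hxv, hxw', Or.inl hxw⟩
    · exact Finset.card_le_two.trans (by norm_num)
    · intro y hy
      rw [Finset.coe_insert, Finset.coe_singleton] at hy
      rcases hy with rfl | rfl
      · exact Or.inr rfl
      · exact Or.inl (Or.inr hx)
    · intro y hy
      have hdom := hD.2.2.2 hy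
      simp only [mem_iUnion, exists_prop, SimpleGraph.mem_neighborSet] at hdom ⊢
      obtain ⟨u, hu, huy⟩ := hdom
      refine ⟨v, by simp, ?_⟩
      by_cases huv : u = v
      · rwa [← huv]
      · obtain ⟨c, hc, hcy⟩ := hy.1.2
        rcases hc with rfl | hc
        · exact hcy
        · obtain rfl : c = w := hc
          exact absurd ⟨u, hu, huv, y, hcy, huy.symm⟩ h

/-- Even a degenerate region between w and d suffices to put w on the boundary of a region of the
first family in Case 3. -/
theorem exists_isSimpleRegion_of_path {d : Plane} (hwd : w ≠ d)
    (h : G.graph.Adj w d ∨ ∃ c, G.graph.Adj w c ∧ G.graph.Adj c d) :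
    ∃ S, G.IsSimpleRegion w d S := by
  rcases h with h | ⟨c, h1, h2⟩
  · exact ⟨_, isSimpleRegion_drawing hwd (.cons h .nil) (by simp [hwd]) (by simp)⟩
  · exact ⟨_, isSimpleRegion_drawing hwd (.cons h1 (.cons h2 .nil))
      (by simp [hwd, h1.ne, h2.ne]) (by simp)⟩

theorem exists_rule2Case3 (hR : G.IsSimpleRegion v w R) (h12 : 12 ≤ (G.vertsIn R).ncard)
    (h6 : 6 ≤ (G.verts ∩ interior R ∩ G.graph.nbhd₃ {v, w}).ncard)
    (hv : (G.graph.domSets v w).Nonempty) (hw : G.graph.domSets w v = ∅) :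
    ∃ G', G.Rule2Case3 v w G' ∧ G'.verts.ncard < G.verts.ncard := by
  have hvw := hR.1
  set J := G.verts ∩ interior R ∩ G.graph.nbhd₃ {v, w} with hJ
  have hJfin : J.Finite := G.finite_verts.subset (inter_subset_left.trans inter_subset_left)
  obtain ⟨x₀, hx₀⟩ : J.Nonempty := Set.nonempty_of_ncard_ne_zero (by omega)
  obtain ⟨D, hD, d, hdD, hdv, hdw, hpath⟩ := exists_domSets_path hvw hx₀.2
    (hR.adj_of_mem_interior hx₀.1).2 hv
  obtain ⟨H₀, z, hzG, hzR, hze, hV₀, hE₀, hadd⟩ :=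
    exists_pendant hR.left_mem.1 hR.isClosed hR.left_mem_frontier.1
  obtain ⟨H₁, hH₁⟩ := H₀.exists_shrink_maximalRegions w ((D : Set Plane) \ {v})
  set H₂ := H₁.delete (G.graph.nbhd₂₃ {v} ∩ G.graph.nbhd₃ {v, w}) with hH₂
  obtain ⟨G', hG'⟩ := H₂.exists_shrink_maximalRegions v
    {u ∈ H₂.verts | ∃ R ∈ H₀.maximalRegions w ((D : Set Plane) \ {v}), u ∈ frontier R}
  refine ⟨G', ⟨hw, D, hD, H₀, H₁, H₂, hadd, hH₁, rfl, hG'⟩, ?_⟩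
  have hind : H₂.IsInduced H₀ := (isInduced_delete _ _).trans hH₁.isInduced
  have hcard₀ : H₀.verts.ncard = G.verts.ncard + 1 := by
    rw [hV₀, Set.ncard_insert_of_notMem hzG G.finite_verts]
  -- If v and w are adjacent, every vertex of R other than v is a neighbour of v. Inner vertices are
  -- then not in N₁(v), so all of J is deleted: at least six against one added.
  by_cases hadj : G.graph.Adj v w
  · have hJsub : J ⊆ G.graph.nbhd₂₃ {v} ∩ G.graph.nbhd₃ {v, w} := by
      intro x hx
      refine ⟨?_, hx.2⟩
      have hxadj := hR.adj_of_mem_interior hx.1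
      have hnb : x ∈ G.graph.nbhd {v} := ⟨by simp [hxadj.1.ne'], v, rfl, hxadj.1⟩
      have hn1 : x ∉ G.graph.nbhd₁ {v} := by
        rintro ⟨-, u, hu, hu'⟩
        apply hu'
        have huR := hR.mem_of_adj_interior hx.1.2 hu
        by_cases h1 : u = v
        · exact Or.inr h1
        · refine Or.inl ⟨h1, v, rfl, ?_⟩
          by_cases h2 : u = w
          · rwa [h2]
          · exact (hR.adj_of_mem ⟨adj_right_mem hu, huR⟩ h1 h2).1
      by_cases hn2 : x ∈ G.graph.nbhd₂ {v}
      · exact Or.inl hn2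
      · exact Or.inr ⟨hnb, fun h => h.elim hn1 hn2⟩
    have hd : Disjoint G'.verts J := by
      rw [disjoint_right]
      exact fun x hx hx' => (hG'.isInduced.verts_subset hx').2 (hJsub hx)
    have h1 := Set.ncard_union_eq hd G'.finite_verts hJfin
    have h2 : G'.verts ∪ J ⊆ H₀.verts := by
      refine union_subset (hG'.isInduced.verts_subset.trans hind.verts_subset) ?_
      rw [hV₀]
      exact fun x hx => Or.inr hx.1.1
    have h3 := Set.ncard_le_ncard h2 H₀.finite_verts
    omega
  · have hadj₀ : ∀ x ∈ G.verts, ∀ y, H₀.graph.Adj x y → y ∈ G.verts → G.graph.Adj x y := by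
      rintro x hx y ⟨e, he, ha⟩ hy
      rw [hE₀] at he
      rcases he with rfl | he
      · have h1 := inter_verts_of_isArc (G := H₀) (by rw [hE₀]; exact mem_insert _ _) ha
        have h2 : z ∈ ({x, y} : Set Plane) := by
          rw [← h1, hV₀]
          exact ⟨right_mem_segment ℝ v z, mem_insert _ _⟩
        rcases h2 with h | h
        · exact absurd ((show z = x from h) ▸ hx) hzG
        · exact absurd ((show z = y from h) ▸ hy) hzG
      · exact ⟨e, he, ha⟩
    have hadj₀' : ∀ x y, G.graph.Adj x y → H₀.graph.Adj x y := by
      rintro x y ⟨e, he, ha⟩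
      exact ⟨e, by rw [hE₀]; exact Or.inr he, ha⟩
    -- A region between w and some u ≠ v that contained v would make v a neighbour of w.
    have hvS : ∀ S ∈ H₀.maximalRegions w ((D : Set Plane) \ {v}), v ∉ S := by
      rintro S ⟨u, hu, hS, -⟩ hvS
      refine hadj (hadj₀ w hR.right_mem.1 v ?_ hR.left_mem.1).symm
      exact (hS.adj_of_mem ⟨by rw [hV₀]; exact Or.inr hR.left_mem.1, hvS⟩ hvw
        fun h => hu.2 h.symm).1
    have hwS : ∀ S ∈ H₀.maximalRegions w ((D : Set Plane) \ {v}), w ∉ interior S := by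
      rintro S ⟨u, hu, hS, -⟩ h
      exact hS.left_mem_frontier.1.2 h
    -- A vertex x of R strictly inside such a region would pull its neighbour v into it, so the
    -- first shrinking spares R. The deletion spares it too: x is adjacent to w, which is neither v
    -- nor a neighbour of v, so x is in N₁(v).
    have hkeep : G.vertsIn R ⊆ H₂.verts := by
      intro x hx
      have hcases : x = v ∨ x = w ∨ (x ≠ v ∧ x ≠ w) := by tauto
      refine ⟨?_, ?_⟩
      · by_contra hx₁
        obtain ⟨S, hS, hxS⟩ := (isInduced_of_reflTransGen hH₁.1).2 x
          (by rw [hV₀]; exact Or.inr hx.1) hx₁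
        rcases hcases with rfl | rfl | ⟨h1, h2⟩
        · exact hvS S hS (interior_subset hxS)
        · exact hwS S hS hxS
        · obtain ⟨u, hu, hS', -⟩ := id hS
          exact hvS S hS (hS'.mem_of_adj_interior hxS
            (hadj₀' _ _ (hR.adj_of_mem hx h1 h2).1.symm))
      · rintro ⟨h23, h3⟩
        have h1 : x ≠ v := fun h => h3.1.1 (by simp [h])
        have h2 : x ≠ w := fun h => h3.1.1 (by simp [h])
        have hxadj := hR.adj_of_mem hx h1 h2
        have hnb : x ∈ G.graph.nbhd {v} := ⟨by simp [h1], v, rfl, hxadj.1⟩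
        have hn1 : x ∈ G.graph.nbhd₁ {v} := by
          refine ⟨hnb, w, hxadj.2.symm, ?_⟩
          rintro (⟨-, c, hc, hcw⟩ | h)
          · obtain rfl : c = v := hc
            exact hadj hcw
          · exact hvw (show w = v from h).symm
        rcases h23 with h | h
        · exact h.1.2 hn1
        · exact h.2 (Or.inl hn1)
    have hV₂ : H₂.vertsIn R = G.vertsIn R := by
      refine subset_antisymm ?_ fun x hx => ⟨hkeep hx, hx.2⟩
      rintro x ⟨hx, hxR⟩
      have := hind.verts_subset hx
      rw [hV₀] at this
      rcases this with rfl | h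
      · exact absurd hxR hzR
      · exact ⟨h, hxR⟩
    -- The end of the pendant edge was placed outside R, so V(R) is unchanged and R is still a
    -- simple region.
    have hR₂ : H₂.IsSimpleRegion v w R := by
      refine hR.transfer ?_ hV₂
      intro e he x hx y hy hev
      have hev₀ : e ∩ H₀.verts = {x, y} := by
        rw [← hev, hV₀]
        refine subset_antisymm ?_ (inter_subset_inter_right _ (subset_insert _ _))
        rintro u ⟨hu, rfl | hu'⟩
        · exact absurd hu (hze e he)
        · exact ⟨hu, hu'⟩
      have hsub : e ∩ H₀.verts ⊆ H₂.verts := by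
        rw [hev₀]
        rintro u (rfl | rfl)
        · exact hx
        · exact hy
      refine ⟨?_, ?_⟩
      · rw [hind.edges_eq, hE₀]
        exact ⟨Or.inr he, hsub⟩
      · rw [← hev₀]
        exact subset_antisymm (inter_subset_inter_right _ hind.verts_subset)
          fun u hu => ⟨hu.1, hsub hu⟩
    -- This region puts w among the boundary vertices used in the last step, so the regions between
    -- v and w are shrunk there: at least five vertices go against one added.
    obtain ⟨T, hT⟩ := exists_isSimpleRegion_of_path (G := H₀) hdw.symm (by
      rcases hpath with h | ⟨c, h1, h2⟩
      · exact Or.inl (hadj₀' _ _ h)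
      · exact Or.inr ⟨c, hadj₀' _ _ h1, hadj₀' _ _ h2⟩)
    obtain ⟨T', hT', -⟩ := hT.exists_maximal
    obtain ⟨S, hS, hRS⟩ := hR₂.exists_maximal
    have hle := hG'.ncard_add_five_le (R := S)
      ⟨w, ⟨hkeep hR.right_mem, T', ⟨d, ⟨hdD, hdv⟩, hT'⟩, hT'.1.left_mem_frontier.1⟩, hS⟩
      (h12.trans (hV₂ ▸ Set.ncard_le_ncard hRS (H₂.finite_vertsIn S)))
    have := Set.ncard_le_ncard hind.verts_subset H₀.finite_verts
    omega

theorem Reduced.ncard_vertsIn_le (hG : G.Reduced) (hR : G.IsSimpleRegion v w R) :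
    (G.vertsIn R).ncard ≤ 11 := by
  by_contra! h12
  have hrule : ∀ G', G.Rule2 G' → ¬ G'.verts.ncard < G.verts.ncard := fun G' h =>
    (hG.2 G' h).ncard_eq.le.not_gt
  obtain ⟨h6, hT⟩ := hR.six_le_and_not_hasSmallTDS h12
  -- The region is symmetric in v and w, so Case 4 is Case 3 for the reversed pair.
  obtain ⟨h6', hT'⟩ := hR.symm.six_le_and_not_hasSmallTDS h12
  have hv := hR.left_mem.1
  have hw := hR.right_mem.1
  rcases (G.graph.domSets v w).eq_empty_or_nonempty with h1 | h1 <;>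
    rcases (G.graph.domSets w v).eq_empty_or_nonempty with h2 | h2
  · obtain ⟨G', hG', hlt⟩ := exists_rule2Case1 hR h6 h1 h2
    exact hrule G' ⟨v, hv, w, hw, hR.1, hT, Or.inl hG'⟩ hlt
  · obtain ⟨G', hG', hlt⟩ := exists_rule2Case3 hR.symm h12 h6' h2 h1
    exact hrule G' ⟨v, hv, w, hw, hR.1, hT, Or.inr (Or.inr (Or.inr hG'))⟩ hlt
  · obtain ⟨G', hG', hlt⟩ := exists_rule2Case3 hR h12 h6 h1 h2
    exact hrule G' ⟨v, hv, w, hw, hR.1, hT, Or.inr (Or.inr (Or.inl hG'))⟩ hlt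
  · obtain ⟨G', hG', hlt⟩ := exists_rule2Case2 hR h12 h1 h2
    exact hrule G' ⟨v, hv, w, hw, hR.1, hT, Or.inr (Or.inl hG')⟩ hlt

end PlaneGraph

theorem lemma5 (G : PlaneGraph) (hG : G.Reduced) (v w : Plane) (R : Set Plane)
    (hR : G.IsSimpleRegion v w R) :
    (G.vertsIn R).ncard ≤ 11 ∧ (G.vertsIn R \ {v, w}).ncard ≤ 9 := by
  have h := hG.ncard_vertsIn_le hR
  refine ⟨h, ?_⟩
  have hsub : {v, w} ⊆ G.vertsIn R := by
    rintro x (rfl | rfl)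
    · exact hR.left_mem
    · exact hR.right_mem
  have h1 := Set.ncard_sdiff_add_ncard_of_subset hsub (G.finite_vertsIn R)
  rw [Set.ncard_pair hR.1] at h1
  omega
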